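/- Logarithms are to base $2$. A binary-input discrete memoryless channel $W$ has input alphabet $\{0,1\}$, a discrete output alphabet $\mathcal Y$ and transition probabilities $W(y|x)$; it is symmetric if there is a permutation $\pi=\pi^{-1}$ of $\mathcal Y$ with $W(y|1)=W(\pi(y)|0)$ for all $y$. Its capacity is the supremum of $I(X;Y)$ over the distributions of the input $X$, where $Y$ is the output. Polar codes. Let $N=2^n$ and $G=RF^{\otimes n}$ over $\mathbb F_2$, where $F=\begin{bmatrix}1&0\\1&1\end{bmatrix}$, $F^{\otimes n}$ is its $n$-th Kronecker power and $R$ is the bit-reversal permutation. For $u\in\{0,1\}^N$ let $W_N(y|u)=\prod_{j=1}^N W(y_j|(uG)_j)$, and let $$W_N^{(i)}(y,u_1^{i-1}|u_i)=\frac1{2^{N-1}}\sum_{u_{i+1},\dots,u_N\in\{0,1\}}W_N(y|u).$$ For $\mathcal A\subseteq\{1,\dots,N\}$ the successive cancellation (SC) decoder computes, for $i=1,\dots,N$ in this order, $\hat u_i=0$ if $i\notin\mathcal A$ or $W_N^{(i)}(y,\hat u_1^{i-1}|0)\ge W_N^{(i)}(y,\hat u_1^{i-1}|1)$, and $\hat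 u_i=1$ otherwise. The nested polar code $P(N,\mathcal A,\mathcal B)$, $\mathcal B\subseteq\mathcal A$, is used as follows. The message $S$ is uniform on $\mathcal S=\{0,1\}^{\mathcal A\setminus\mathcal B}$ and $T$ is uniform on $\{0,1\}^{\mathcal B}$, independent of $S$. Let $U\in\{0,1\}^N$ have the entries of $S$ on $\mathcal A\setminus\mathcal B$, those of $T$ on $\mathcal B$, and $0$ outside $\mathcal A$. The codeword $X^N=UG=TG_{\mathcal B}\oplus SG_{\mathcal A\setminus\mathcal B}$ is sent, where $G_{\mathcal I}$ denotes the rows of $G$ indexed by $\mathcal I$. Theorem. Let $W$ (main channel, output alphabet $\mathcal Y$) and $\tilde W$ (wiretapper's channel, output alphabet $\mathcal Z$) be symmetric binary-input discrete memoryless channels with capacities $C_M$ and $C_W$, and let $\tilde W$ be stochastically degraded with respect to $W$, i.e. $\tilde W(z|x)=\sum_{y}Q(z|y)W(y|x)$ for some channel $Q$ from $\mathcal Y$ to $\mathcal Z$. Let $(R,R_e)$ be real numbers with $$R_e\le R\le C_M,\qquad 0\le R_e\le C_M-C_W.$$ Then for every $\epsilon>0$ there is $n_0$ such that for every $n\ge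 n_0$, with $N=2^n$, there are sets $\mathcal B\subseteq\mathcal A\subseteq\{1,\dots,N\}$ for which the nested polar code $P(N,\mathcal A,\mathcal B)$ satisfies the following, where $Y^N$ and $Z^N$ are the outputs of $N$ independent uses of $W$ and of $\tilde W$ with input $X^N$, and $\hat U$ is the output of the SC decoder (for $W$ and $\mathcal A$) applied to $Y^N$: 1. $\frac1N\log|\mathcal S|>R-\epsilon$; 2. $\Pr(\hat U_{\mathcal A\setminus\mathcal B}\ne S)<\epsilon$, and indeed $\Pr(\hat U\ne U)<\epsilon$; 3. $\frac1N H(S|Z^N)>R_e-\epsilon$. -/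

import Mathlib

open scoped ENNReal

noncomputable section

namespace NestedPolar

/-! ### Binary-input discrete memoryless channels -/

/-- A binary-input channel with output alphabet `Y`: `W x y` is the transition probability
`W(y | x)`. The output laws are discrete; the alphabet need not be finite. -/
abbrev BinaryChannel (Y : Type*) := ZMod 2 → PMF Y

/-- `W` is symmetric: some involution `π` of the output alphabet satisfies
`W(y | 1) = W(π y | 0)`. -/
def IsSymmetric {Y : Type*} (W : BinaryChannel Y) : Prop :=
  ∃ π : Equiv.Perm Y, Function.Involutive π ∧ ∀ y, W 1 y = W 0 (π y)

/-- `V` is stochastically degraded with respect to `W`: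
`V(z | x) = ∑ y, Q(z | y) W(y | x)` for some channel `Q` from `Y` to `Z`. -/
def IsDegraded {Y Z : Type*} (V : BinaryChannel Z) (W : BinaryChannel Y) : Prop :=
  ∃ Q : Y → PMF Z, ∀ x z, V x z = ∑' y, Q y z * W x y

/-- Mutual information `I(X; Y)`, in bits, of the input `X ∼ p` and the output `Y` of `W`. -/
def mutualInfo {Y : Type*} (p : PMF (ZMod 2)) (W : BinaryChannel Y) : ℝ :=
  ∑' y, ∑ x, (p x * W x y).toReal * Real.logb 2 ((W x y).toReal / (p.bind W y).toReal)

/-- Shannon capacity, in bits: the supremum of `I(X; Y)` over all input distributions. -/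
def capacity {Y : Type*} (W : BinaryChannel Y) : ℝ :=
  ⨆ p : PMF (ZMod 2), mutualInfo p W

/-- Conditional entropy `H(S | Z)`, in bits, for a pair `(S, Z)` with law `P`. -/
def condEntropy {S Z : Type*} [Fintype S] (P : PMF (S × Z)) : ℝ :=
  ∑' z, ∑ s, -((P (s, z)).toReal *
    Real.logb 2 ((P (s, z)).toReal / (P.map Prod.snd z).toReal))

theorem tsum_pi_prod {Y : Type*} : ∀ {N : ℕ} (f : Fin N → Y → ℝ≥0∞),
    ∑' y : Fin N → Y, ∏ i, f i (y i) = ∏ i, ∑' a, f i a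
  | 0, f => by simp
  | N + 1, f => by
      rw [← (Fin.consEquiv fun _ : Fin (N + 1) => Y).tsum_eq, ENNReal.tsum_prod']
      simp only [Fin.consEquiv, Equiv.coe_fn_mk, Fin.prod_univ_succ, Fin.cons_zero,
        Fin.cons_succ]
      simp only [ENNReal.tsum_mul_left, ENNReal.tsum_mul_right,
        tsum_pi_prod (fun i : Fin N => f i.succ)]

/-- `N` independent uses of `W` with input word `x`:
the output word `y` has probability `∏ i, W(y i | x i)`. -/
def blockChannel {Y : Type*} {N : ℕ} (W : BinaryChannel Y) (x : Fin N → ZMod 2) :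
    PMF (Fin N → Y) :=
  ⟨fun y => ∏ i, W (x i) (y i), by
    have h : ∑' y : Fin N → Y, ∏ i, W (x i) (y i) = 1 := by
      rw [tsum_pi_prod (fun i => W (x i))]
      simp [PMF.tsum_coe]
    exact h ▸ ENNReal.summable.hasSum⟩

/-! ### The polar transform -/

/-- The kernel `F`. -/
def kernelF : Matrix (Fin 2) (Fin 2) (ZMod 2) := !![1, 0; 1, 1]

/-- The binary digits of an index, least significant first. -/
def bits (n : ℕ) (i : Fin (2 ^ n)) : Fin n → Fin 2 := finFunctionFinEquiv.symm i

/-- The `n`-th Kronecker power of `F`: its `(i, j)` entry is the product, over the `n` digit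
positions, of the entries of `F` at the digits of `i` and `j`. -/
def kroneckerPow (n : ℕ) : Matrix (Fin (2 ^ n)) (Fin (2 ^ n)) (ZMod 2) :=
  Matrix.of fun i j => ∏ k, kernelF (bits n i k) (bits n j k)

/-- Bit reversal of an index. -/
def bitReversal (n : ℕ) (i : Fin (2 ^ n)) : Fin (2 ^ n) :=
  finFunctionFinEquiv fun k => bits n i k.rev

/-- The generator matrix `G = R F^{⊗ n}`: the rows of `F^{⊗ n}` in bit-reversed order. -/
def generator (n : ℕ) : Matrix (Fin (2 ^ n)) (Fin (2 ^ n)) (ZMod 2) :=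
  (kroneckerPow n).submatrix (bitReversal n) id

/-- The vector channel `W_N(y | u)`: the word `u G` is sent over `N = 2 ^ n` copies of `W`. -/
def vectorChannel {Y : Type*} {n : ℕ} (W : BinaryChannel Y) (u : Fin (2 ^ n) → ZMod 2) :
    PMF (Fin (2 ^ n) → Y) :=
  blockChannel W (Matrix.vecMul u (generator n))

/-- The channel seen by the `i`-th bit, with value `b`, with output `y` and the previous bits
`past`: the sum of `2 ^ (-(N - 1)) * W_N(y | v)` over all `v` that extend `past` and `b`. -/
def bitChannel {Y : Type*} {n : ℕ} (W : BinaryChannel Y) (i : Fin (2 ^ n))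
    (y : Fin (2 ^ n) → Y) (past : {j : Fin (2 ^ n) // j < i} → ZMod 2) (b : ZMod 2) : ℝ≥0∞ :=
  ∑ v : Fin (2 ^ n) → ZMod 2 with (∀ j, v j.1 = past j) ∧ v i = b,
    (2 ^ (2 ^ n - 1))⁻¹ * vectorChannel W v y

/-- Successive cancellation decoding of the polar code with information set `A` (the bits
outside `A` are frozen to `0`): the bits are decided in increasing order, and a bit of `A` is
decided as `0` iff its likelihood ratio, given the earlier decisions, is at least `1`. -/
def scDecode {Y : Type*} {n : ℕ} (W : BinaryChannel Y) (A : Finset (Fin (2 ^ n)))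
    (y : Fin (2 ^ n) → Y) (i : Fin (2 ^ n)) : ZMod 2 :=
  if i ∉ A ∨ bitChannel W i y (fun j => scDecode W A y j.1) 1 ≤
      bitChannel W i y (fun j => scDecode W A y j.1) 0
  then 0 else 1
termination_by i.val
decreasing_by all_goals exact j.2

/-! ### Nested polar codes for the wiretap channel -/

/-- The nested polar code `P(N, A, B)` of length `N = 2 ^ n`, with `B ⊆ A`. -/
structure NestedPolarCode (n : ℕ) where
  A : Finset (Fin (2 ^ n))
  B : Finset (Fin (2 ^ n))
  subset : B ⊆ A

namespace NestedPolarCode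

variable {n : ℕ} (P : NestedPolarCode n)

/-- The messages: bit vectors indexed by `A \ B`; a message selects a coset of `P(N, B)`. -/
abbrev Message : Type := {i : Fin (2 ^ n) // i ∈ P.A \ P.B} → ZMod 2

/-- The encoder's randomness: bit vectors indexed by `B`. -/
abbrev Randomness : Type := {i : Fin (2 ^ n) // i ∈ P.B} → ZMod 2

/-- The bits `u`: those of the message on `A \ B`, the random ones on `B`, and `0` off `A`.
Hence `u G = t G_B + s G_{A \ B}` for the message `s` and the randomness `t`. -/
def inputBits (s : P.Message) (t : P.Randomness) (i : Fin (2 ^ n)) : ZMod 2 :=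
  if hs : i ∈ P.A \ P.B then s ⟨i, hs⟩ else if ht : i ∈ P.B then t ⟨i, ht⟩ else 0

/-- The joint law of message, randomness and the output of the channel `V`: message and
randomness are uniform and independent, and the codeword `u G` is sent over `V`. -/
def law {Y : Type*} (V : BinaryChannel Y) :
    PMF ((P.Message × P.Randomness) × (Fin (2 ^ n) → Y)) :=
  (PMF.uniformOfFintype (P.Message × P.Randomness)).bind fun st =>
    (vectorChannel V (P.inputBits st.1 st.2)).map fun y => (st, y)

/-- The rate `(1 / N) log₂ |S|`. -/
def rate : ℝ := Real.logb 2 (Fintype.card P.Message) / 2 ^ n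

/-- The message decoder `φ`: the bits in `A \ B` of the SC decoder for `P(N, A)`. -/
def decodeMessage {Y : Type*} (W : BinaryChannel Y) (y : Fin (2 ^ n) → Y) : P.Message :=
  fun i => scDecode W P.A y i.1

/-- The probability `P(φ(Y^N) ≠ S)` of decoding the message incorrectly. -/
def messageErrorProb {Y : Type*} (W : BinaryChannel Y) : ℝ :=
  ((P.law W).toOuterMeasure {ω | P.decodeMessage W ω.2 ≠ ω.1.1}).toReal

/-- The block error probability of SC decoding: some bit of `u` is decided incorrectly. -/
def blockErrorProb {Y : Type*} (W : BinaryChannel Y) : ℝ :=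
  ((P.law W).toOuterMeasure {ω | scDecode W P.A ω.2 ≠ P.inputBits ω.1.1 ω.1.2}).toReal

/-- The equivocation `H(S | Z^N)`, in bits, where `Z^N` is the output of `V`. -/
def equivocation {Z : Type*} (V : BinaryChannel Z) : ℝ :=
  condEntropy ((P.law V).map fun ω => (ω.1.1, ω.2))

end NestedPolarCode

end NestedPolar

end

noncomputable section

namespace NestedPolar

/-! ### Indices of the polarization tree -/

/-! Polarization. Two uses of a binary-input channel produce a worse and a better channel (`minus`,
`plus`), and the bit channels at length `2 ^ (n + 1)` arise in this way from those at length `2 ^ n`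
(`bitKernel_child_zero`, `bitKernel_child_one`). The step conserves the mean mutual information with
uniform input, while a Bhattacharyya parameter `Z` turns into `Z ^ 2` on the better side and into a
value between `Z √(2 - Z ^ 2)` and `2 Z` on the worse side. Hence the fourth root of `Z (1 - Z)`
contracts on average by a fixed factor (`potential_step`), and most bit channels have `Z` near 0 or
near 1. Those near 1 carry almost no information, so conservation forces a proportion of nearly
`info W` to lie near 0 (`exists_goodFraction`). Most paths in the tree also square `Z` again and
again, which improves the bound to `4 ^ (-n)`, that is `N ^ (-2)` (`fast_polarization`). For a
symmetric channel `info W` is the capacity (`IsSymmetric.capacity_eq`).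

Reliability. Let `A` be the indices that are good for the main channel. Successive cancellation
succeeds unless some bit of `A` is beaten by its complement given the true past; by symmetry this
has probability at most `Z` for every input, and a union bound finishes (`blockErrorProb_le`).

Secrecy. Write `H(S|Z) = H(S,T) - I(S,T;Z) - H(T|S,Z)`. The first term is `|A|`. The second is at
most `N` times the wiretapper's capacity, because every codeword has that same divergence from the
product of the mean output laws. The third is small by Fano's inequality if `B` consists of indices
good for the wiretapper: given `S`, the randomness can then be recovered from the wiretapper's
output. `condEntropy_sum_ge` and `equivocation_ge` make this precise. Degradedness places the
wiretapper's good indices inside `A` (`IsDegraded.bhatt_bitKernel_le`). -/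

/-- The index `2 i + b`: the `b`-th child of `i` in the polarization tree. -/
def child {n : ℕ} (i : Fin (2 ^ n)) (b : Fin 2) : Fin (2 ^ (n + 1)) :=
  finProdFinEquiv (i, b)

theorem child_val {n : ℕ} (i : Fin (2 ^ n)) (b : Fin 2) :
    (child i b : ℕ) = b + 2 * i := rfl

theorem sum_child {n : ℕ} {M : Type*} [AddCommMonoid M] (f : Fin (2 ^ (n + 1)) → M) :
    ∑ j, f j = ∑ i : Fin (2 ^ n), (f (child i 0) + f (child i 1)) := by
  refine ((finProdFinEquiv (m := 2 ^ n) (n := 2)).sum_comp f).symm.trans ?_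
  rw [Fintype.sum_prod_type]
  exact Finset.sum_congr rfl fun i _ => Fin.sum_univ_two _

/-! ### A potential that contracts along the polarization tree -/

/-- The contraction rate of `potential` under a polarization step. -/
def potentialRate : ℝ := (√√2 + √√(27 / 32) / √√2) / 2

/-- A function of the Bhattacharyya parameter that vanishes at `0` and `1`. -/
def potential (z : ℝ) : ℝ := √√(z * (1 - z))

theorem sqrt_sqrt_pow_four {x : ℝ} (hx : 0 ≤ x) : √√x ^ 4 = x := by
  rw [show 4 = 2 * 2 from rfl, pow_mul, Real.sq_sqrt (Real.sqrt_nonneg _), Real.sq_sqrt hx]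

theorem potential_nonneg (z : ℝ) : 0 ≤ potential z := Real.sqrt_nonneg _

theorem potential_le_one {z : ℝ} (h0 : 0 ≤ z) (h1 : z ≤ 1) : potential z ≤ 1 := by
  unfold potential
  rw [Real.sqrt_le_left zero_le_one, Real.sqrt_le_left (by norm_num)]
  nlinarith

theorem potentialRate_pos : 0 < potentialRate := by
  unfold potentialRate
  positivity

theorem potentialRate_lt_one : potentialRate < 1 := by
  unfold potentialRate
  have h1 : √√(2 : ℝ) ≤ 1.19 := by
    rw [Real.sqrt_le_left (by norm_num), Real.sqrt_le_left (by norm_num)]; norm_num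
  have h0 : 1 ≤ √√(2 : ℝ) := by
    rw [Real.one_le_sqrt, Real.one_le_sqrt]; norm_num
  have h2 : √√(27 / 32 : ℝ) ≤ 0.9585 := by
    rw [Real.sqrt_le_left (by norm_num), Real.sqrt_le_left (by norm_num)]; norm_num
  -- With `k = √√2` the claim is `√√(27/32) < k (2 - k) = 1 - (k - 1) ^ 2`, and `1 - 0.19 ^ 2 >
  -- 0.9585`.
  have h3 : √√(27 / 32 : ℝ) / √√2 < 2 - √√(2 : ℝ) := by
    rw [div_lt_iff₀ (by linarith)]
    nlinarith
  linarith

/-- The two children multiply the potential by factors `a` (better) and `b` (worse). Neither exceeds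
`k = √√2`, and they cannot both be large since `a b ≤ √√(27/32)`. Expanding `(k - a) (k - b) ≥ 0`
gives `a + b ≤ k + a b / k`, which is twice the contraction rate. -/
theorem potential_step {z y : ℝ} (hz0 : 0 ≤ z) (hz1 : z ≤ 1) (hy0 : 0 ≤ y) (hy1 : y ≤ 1)
    (hle : y ≤ 2 * z) (hge : z ^ 2 * (2 - z ^ 2) ≤ y ^ 2) :
    potential y + potential (z ^ 2) ≤ 2 * potentialRate * potential z := by
  rcases hz0.eq_or_lt with rfl | hz0
  · have : y = 0 := by linarith
    subst this
    simp [potential]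
  rcases hz1.eq_or_lt with rfl | hz1
  · have : y = 1 := by nlinarith
    subst this
    simp [potential]
  have hyz : z ≤ y := by
    apply le_of_sq_le_sq _ hy0
    nlinarith [mul_nonneg (sq_nonneg z) (show (0 : ℝ) ≤ 1 - z ^ 2 by nlinarith)]
  have hg : 0 < z * (1 - z) := mul_pos hz0 (by linarith)
  set a := √√(z * (1 + z)) with ha
  set b := √√(y * (1 - y) / (z * (1 - z))) with hb
  have hA : potential (z ^ 2) = a * potential z := by
    unfold potential
    rw [ha, ← Real.sqrt_mul (Real.sqrt_nonneg _), ← Real.sqrt_mul (by positivity)]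
    congr 2; ring
  have hB : potential y = b * potential z := by
    unfold potential
    rw [hb, ← Real.sqrt_mul (Real.sqrt_nonneg _), ← Real.sqrt_mul
      (div_nonneg (mul_nonneg hy0 (by linarith)) hg.le), div_mul_cancel₀ _ hg.ne']
  have hak : a ≤ √√2 := by
    apply Real.sqrt_le_sqrt; apply Real.sqrt_le_sqrt; nlinarith
  have hbk : b ≤ √√2 := by
    apply Real.sqrt_le_sqrt; apply Real.sqrt_le_sqrt
    rw [div_le_iff₀ hg]
    nlinarith
  have hab : a * b ≤ √√(27 / 32) := by
    rw [ha, hb, ← Real.sqrt_mul (Real.sqrt_nonneg _), ← Real.sqrt_mul (by positivity)]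
    apply Real.sqrt_le_sqrt; apply Real.sqrt_le_sqrt
    rw [mul_div_assoc', div_le_iff₀ hg]
    -- `2 y (1 - y) ≤ 1 - y ^ 2`, and the lower bound on `y ^ 2` says exactly that `1 - y ^ 2 ≤ (1 -
    -- z ^ 2) ^ 2`.
    have h1 : 2 * (y * (1 - y)) ≤ (1 - z ^ 2) ^ 2 := by nlinarith
    -- The maximum is at `z = 1/2`; the difference of the two sides is the product in the hint.
    have h2 : (1 + z) ^ 3 * (1 - z) ≤ 27 / 16 := by
      nlinarith [mul_nonneg (sq_nonneg (z - 1 / 2))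
        (show 0 ≤ z ^ 2 + 3 * z + 11 / 4 by positivity)]
    have h3 : z * (1 + z) * (2 * (y * (1 - y))) ≤ z * (1 + z) * (1 - z ^ 2) ^ 2 :=
      mul_le_mul_of_nonneg_left h1 (by positivity)
    have h4 := mul_le_mul_of_nonneg_left h2 hg.le
    nlinarith
  have hk : 0 < √√(2 : ℝ) := by positivity
  have hsum : b + a ≤ 2 * potentialRate := by
    have : b + a ≤ √√2 + √√(27 / 32) / √√2 := by
      rw [← sub_le_iff_le_add', le_div_iff₀ hk]
      nlinarith [mul_nonneg (sub_nonneg.2 hak) (sub_nonneg.2 hbk)]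
    unfold potentialRate
    linarith
  rw [hA, hB, ← add_mul]
  exact mul_le_mul_of_nonneg_right hsum (potential_nonneg _)

/-! ### Fast polarization -/

/-- The properties of the Bhattacharyya parameters `Z` and the mutual informations `I` of the
channels of the polarization tree that force polarization. -/
structure IsPolarizing (Z I : ∀ n, Fin (2 ^ n) → ℝ) : Prop where
  Z_nonneg : ∀ n i, 0 ≤ Z n i
  Z_le_one : ∀ n i, Z n i ≤ 1
  Z_plus : ∀ n i, Z (n + 1) (child i 1) = Z n i ^ 2
  Z_minus_le : ∀ n i, Z (n + 1) (child i 0) ≤ 2 * Z n i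
  le_Z_minus_sq : ∀ n i, Z n i ^ 2 * (2 - Z n i ^ 2) ≤ Z (n + 1) (child i 0) ^ 2
  I_le_one : ∀ n i, I n i ≤ 1
  I_le_add : ∀ n i, 2 * I n i ≤ I (n + 1) (child i 0) + I (n + 1) (child i 1)
  I_le : ∀ n i, I n i ≤ 3 * (1 - Z n i)

/-- The number of indices at level `n` whose parameter is at most `x`. -/
def goodCount (Z : ∀ n, Fin (2 ^ n) → ℝ) (n : ℕ) (x : ℝ) : ℝ :=
  ∑ i, if Z n i ≤ x then 1 else 0

theorem goodCount_eq_card (Z : ∀ n, Fin (2 ^ n) → ℝ) (n : ℕ) (x : ℝ) :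
    goodCount Z n x = (Finset.univ.filter fun i => Z n i ≤ x).card := by
  simp [goodCount]

theorem goodCount_mono (Z : ∀ n, Fin (2 ^ n) → ℝ) (n : ℕ) {x y : ℝ} (h : x ≤ y) :
    goodCount Z n x ≤ goodCount Z n y := by
  refine Finset.sum_le_sum fun i _ => ?_
  split_ifs with h1 h2 <;> first | exact absurd (h1.trans h) h2 | norm_num

theorem goodCount_nonneg (Z : ∀ n, Fin (2 ^ n) → ℝ) (n : ℕ) (x : ℝ) : 0 ≤ goodCount Z n x :=
  Finset.sum_nonneg fun i _ => by split_ifs <;> norm_num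

/-- For every `ε > 0`, from some level on at least a fraction `c - ε` of the indices has a
parameter of at most `2 ^ (- r n)`. -/
def GoodFraction (Z : ∀ n, Fin (2 ^ n) → ℝ) (c r : ℝ) : Prop :=
  ∀ ε > 0, ∃ n₀ : ℕ, ∀ n ≥ n₀, (c - ε) * 2 ^ n ≤ goodCount Z n (2 ^ (-(r * n)) : ℝ)

namespace IsPolarizing

variable {Z I : ∀ n, Fin (2 ^ n) → ℝ}

theorem sum_I (h : IsPolarizing Z I) (n : ℕ) : I 0 0 * 2 ^ n ≤ ∑ i, I n i := by
  induction n with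
  | zero => simp
  | succ n ih =>
    rw [sum_child]
    calc I 0 0 * 2 ^ (n + 1) = 2 * (I 0 0 * 2 ^ n) := by ring
      _ ≤ 2 * ∑ i, I n i := by linarith
      _ = ∑ i, 2 * I n i := by rw [Finset.mul_sum]
      _ ≤ _ := Finset.sum_le_sum fun i _ => h.I_le_add n i

theorem sum_potential (h : IsPolarizing Z I) (n : ℕ) :
    ∑ i, potential (Z n i) ≤ potentialRate ^ n * 2 ^ n := by
  induction n with
  | zero => simpa using potential_le_one (h.Z_nonneg 0 0) (h.Z_le_one 0 0)
  | succ n ih =>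
    rw [sum_child]
    calc _ ≤ ∑ i, 2 * potentialRate * potential (Z n i) := Finset.sum_le_sum fun i _ => by
            rw [h.Z_plus]
            exact potential_step (h.Z_nonneg _ _) (h.Z_le_one _ _) (h.Z_nonneg _ _)
              (h.Z_le_one _ _) (h.Z_minus_le _ _) (h.le_Z_minus_sq _ _)
      _ = 2 * potentialRate * ∑ i, potential (Z n i) := by rw [Finset.mul_sum]
      _ ≤ 2 * potentialRate * (potentialRate ^ n * 2 ^ n) :=
            mul_le_mul_of_nonneg_left ih (by linarith [potentialRate_pos])
      _ = _ := by ring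

theorem goodCount_succ (h : IsPolarizing Z I) (n : ℕ) {x y w : ℝ} (hx : 2 * x ≤ w)
    (hy : y ^ 2 ≤ w) :
    goodCount Z n x + goodCount Z n y ≤ goodCount Z (n + 1) w := by
  unfold goodCount
  rw [sum_child, ← Finset.sum_add_distrib]
  refine Finset.sum_le_sum fun i _ => add_le_add ?_ ?_
  · have := h.Z_minus_le n i
    split_ifs <;> linarith
  · have h1 := h.Z_plus n i
    have h2 := h.Z_nonneg n i
    split_ifs with h3 h4 <;> nlinarith

/-- Neither kind of step more than doubles a parameter in `[0, 1]`, so all `2 ^ k` descendants of a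
good index stay below `2 ^ k ζ`. -/
theorem pow_two_mul_goodCount_le (h : IsPolarizing Z I) (m k : ℕ) {ζ x : ℝ} (hζ : 0 ≤ ζ)
    (hx : 2 ^ k * ζ ≤ x) :
    2 ^ k * goodCount Z m ζ ≤ goodCount Z (m + k) x := by
  induction k generalizing x with
  | zero => simpa using goodCount_mono Z m (by simpa using hx)
  | succ k ih =>
    by_cases hx1 : 1 ≤ x / 2
    · have hall : ∀ n y, 1 ≤ y → goodCount Z n y = 2 ^ n := by
        intro n y hy
        unfold goodCount
        simp [(h.Z_le_one n _).trans hy]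
      rw [hall _ x (by linarith)]
      have : goodCount Z m ζ ≤ 2 ^ m :=
        (goodCount_mono Z m (le_max_left ζ 1)).trans_eq (hall m _ (le_max_right _ _))
      calc 2 ^ (k + 1) * goodCount Z m ζ ≤ 2 ^ (k + 1) * 2 ^ m := by gcongr
        _ = _ := by rw [← pow_add]; congr 1; omega
    · push Not at hx1
      have hx2 : 2 ^ k * ζ ≤ x / 2 := by rw [pow_succ] at hx; linarith
      have hpos : 0 ≤ 2 ^ k * ζ := by positivity
      have h2 := ih hx2
      have h3 := h.goodCount_succ (m + k) (x := x / 2) (y := x / 2) (w := x) (by linarith)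
        (by nlinarith)
      rw [pow_succ]
      rw [← add_assoc]
      linarith

/-- Of the `2 ^ k` descendants only the one reached by worse steps alone is never squared. Every
other one is squared at least once, and the doublings along its path cost at most a factor `4 ^ k`.
-/
theorem pow_two_sub_one_mul_goodCount_le (h : IsPolarizing Z I) (m k : ℕ) {ζ x : ℝ} (hζ : 0 ≤ ζ)
    (hx : 4 ^ k * ζ ^ 2 ≤ x) :
    (2 ^ k - 1) * goodCount Z m ζ ≤ goodCount Z (m + k) x := by
  induction k generalizing x with
  | zero => simpa using goodCount_nonneg Z m x
  | succ k ih =>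
    have h0 : 0 ≤ 4 ^ k * ζ ^ 2 := by positivity
    rw [pow_succ] at hx
    have h1 := ih (x := x / 2) (by linarith)
    have h2 := h.pow_two_mul_goodCount_le m k hζ le_rfl
    have h3 := h.goodCount_succ (m + k) (x := x / 2) (y := 2 ^ k * ζ) (w := x) (by linarith) (by
      rw [mul_pow, ← pow_mul, mul_comm k 2, pow_mul]; norm_num; linarith)
    rw [pow_succ, ← add_assoc]
    linarith

/-- A small proportion `k ≈ n / L` of the levels is spent on one squaring: the exponent `r (n - k)`
doubles, up to a loss of `2 k` from doublings, while the fraction of good indices loses only a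
factor `1 - 2 ^ (-k)`. -/
theorem goodFraction_mul (h : IsPolarizing Z I) {r : ℝ} (hr : 0 < r) (c : ℝ)
    (hQ : GoodFraction Z c r) :
    GoodFraction Z c (3 / 2 * r) := by
  intro ε hε
  -- This is what `2 r (n - k) - 2 k ≥ (3/2) r n` requires when `k ≤ n / L`.
  obtain ⟨L, hL⟩ := exists_nat_ge (4 * (1 + r) / r)
  have hL0 : 0 < (L : ℝ) := lt_of_lt_of_le (by positivity) hL
  have hLpos : 0 < L := by exact_mod_cast hL0
  obtain ⟨n₁, hn₁⟩ := hQ (ε / 2) (by positivity)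
  obtain ⟨k₀, hk₀⟩ := exists_pow_lt_of_lt_one (show 0 < ε / (2 * (|c| + 1)) by positivity)
    (show (1 / 2 : ℝ) < 1 by norm_num)
  -- The first bound gives `n - k ≥ n₁`, since `k ≤ n / 2`; the second gives `k ≥ k₀`.
  refine ⟨max (2 * n₁) (L * k₀ + 2 * L), fun n hn => ?_⟩
  have hnk : L * k₀ + 2 * L ≤ n := (le_max_right _ _).trans hn
  by_cases hc : c - ε ≤ 0
  · exact (mul_nonpos_of_nonpos_of_nonneg hc (by positivity)).trans (goodCount_nonneg _ _ _)
  push Not at hc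
  set k := n / L with hk
  have hL4 : 4 ≤ L := by
    have : (4 : ℝ) ≤ L := le_trans (by rw [le_div_iff₀ hr]; linarith) hL
    exact_mod_cast this
  have hkn : 2 * k ≤ n := by
    have : k * L ≤ n := Nat.div_mul_le_self n L
    nlinarith
  have hkk : k₀ ≤ k := by
    rw [hk, Nat.le_div_iff_mul_le hLpos]
    nlinarith
  have hm : n₁ ≤ n - k := by
    have := (le_max_left (2 * n₁) (L * k₀ + 2 * L)).trans hn
    omega
  have hkL : (k : ℝ) * L ≤ n := by exact_mod_cast Nat.div_mul_le_self n L
  have hmk : n - k + k = n := by omega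
  have hmr : ((n - k : ℕ) : ℝ) = n - k := by
    rw [Nat.cast_sub (by omega)]
  have h1 := hn₁ (n - k) hm
  have h2 := h.pow_two_sub_one_mul_goodCount_le (n - k) k
    (ζ := (2 : ℝ) ^ (-(r * (n - k : ℕ)))) (x := (2 : ℝ) ^ (-(3 / 2 * r * n))) (by positivity) (by
      rw [show (4 : ℝ) = 2 ^ (2 : ℝ) by norm_num, ← Real.rpow_natCast, ← Real.rpow_mul (by norm_num),
        ← Real.rpow_natCast, ← Real.rpow_mul (by norm_num), ← Real.rpow_add (by norm_num)]
      apply Real.rpow_le_rpow_of_exponent_le (by norm_num)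
      rw [hmr]
      push_cast
      rw [div_le_iff₀ hr] at hL
      have : (k : ℝ) * (4 * (1 + r)) ≤ n * r := by
        calc (k : ℝ) * (4 * (1 + r)) ≤ k * (L * r) := by gcongr
          _ = (k * L) * r := by ring
          _ ≤ _ := by gcongr
      nlinarith)
  rw [hmk] at h2
  refine le_trans ?_ h2
  have hpow : (1 / 2 : ℝ) ^ k ≤ ε / (2 * (|c| + 1)) :=
    (pow_le_pow_of_le_one (by norm_num) (by norm_num) hkk).trans hk₀.le
  have h2k : (1 : ℝ) ≤ 2 ^ k := one_le_pow₀ (by norm_num)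
  calc (c - ε) * 2 ^ n ≤ ((1 - (1 / 2) ^ k) * (c - ε / 2)) * 2 ^ n := by
        gcongr
        have hc' : c ≤ |c| := le_abs_self c
        have : (1 / 2 : ℝ) ^ k * (c - ε / 2) ≤ ε / 2 := by
          calc (1 / 2 : ℝ) ^ k * (c - ε / 2) ≤ ε / (2 * (|c| + 1)) * (|c| + 1) := by
                gcongr
                · linarith
                · linarith
            _ = ε / 2 := by field_simp
        linarith
    _ = (2 ^ k - 1) * ((c - ε / 2) * 2 ^ (n - k)) := by
        have : (2 : ℝ) ^ n = 2 ^ (n - k) * 2 ^ k := by rw [← pow_add, hmk]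
        rw [this]
        have h3 : (1 / 2 : ℝ) ^ k * 2 ^ k = 1 := by rw [← mul_pow]; norm_num
        linear_combination (-(c - ε / 2) * 2 ^ (n - k)) * h3
    _ ≤ _ := mul_le_mul_of_nonneg_left h1 (by linarith)

/-- By Markov's inequality the potential reaches `√ρ ^ n` on at most a fraction `√ρ ^ n` of the
indices. Elsewhere `Z (1 - Z) ≤ ρ ^ (2 n)`, so either `Z ≤ ρ ^ n` or `Z` is so close to 1 that the
mutual information is negligible. Since the mean mutual information is at least `I 0 0`, the first
case must account for nearly that fraction. -/
theorem exists_goodFraction (h : IsPolarizing Z I) : ∃ r > 0, GoodFraction Z (I 0 0) r := by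
  set ρ := potentialRate with hρ
  have hρ0 : 0 < ρ := potentialRate_pos
  have hρ1 : ρ < 1 := potentialRate_lt_one
  have hlog : Real.logb 2 ρ < 0 := Real.logb_neg (by norm_num) hρ0 hρ1
  refine ⟨-Real.logb 2 ρ, by linarith, fun ε hε => ?_⟩
  have hσ0 : 0 < √ρ := Real.sqrt_pos.2 hρ0
  have hσ1 : √ρ < 1 := by rw [Real.sqrt_lt' one_pos]; simpa using hρ1
  obtain ⟨n₁, hn₁⟩ := exists_pow_lt_of_lt_one (show 0 < ε / 4 by positivity) hσ1
  obtain ⟨n₂, hn₂⟩ := exists_pow_lt_of_lt_one (show (0 : ℝ) < 1 / 2 by positivity) hρ1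
  obtain ⟨n₃, hn₃⟩ := exists_pow_lt_of_lt_one (show (0 : ℝ) < ε / 6 by positivity) hρ1
  refine ⟨max n₁ (max n₂ n₃), fun n hn => ?_⟩
  have e1 : √ρ ^ n ≤ ε / 4 :=
    (pow_le_pow_of_le_one hσ0.le hσ1.le ((le_max_left _ _).trans hn)).trans hn₁.le
  have e2 : ρ ^ n ≤ 1 / 2 := (pow_le_pow_of_le_one hρ0.le hρ1.le
    ((le_max_left n₂ n₃).trans ((le_max_right _ _).trans hn))).trans hn₂.le
  have e3 : ρ ^ n ≤ ε / 6 := (pow_le_pow_of_le_one hρ0.le hρ1.le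
    ((le_max_right n₂ n₃).trans ((le_max_right _ _).trans hn))).trans hn₃.le
  have hthr : (2 : ℝ) ^ (-(-Real.logb 2 ρ * n)) = ρ ^ n := by
    rw [neg_mul, neg_neg, Real.rpow_mul (by norm_num), Real.rpow_logb (by norm_num) (by norm_num)
      hρ0, Real.rpow_natCast]
  rw [hthr]
  have hρn : 0 < ρ ^ n := by positivity
  have hσn : 0 < √ρ ^ n := by positivity
  have hσσ : √ρ ^ n * √ρ ^ n = ρ ^ n := by rw [← mul_pow, Real.mul_self_sqrt hρ0.le]
  -- The three summands cover the good indices, the exceptional set in Markov's inequality, and the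
  -- indices with `Z` near 1.
  have key : ∀ i, I n i ≤ (if Z n i ≤ ρ ^ n then 1 else 0) + potential (Z n i) / √ρ ^ n + ε / 2 := by
    intro i
    have z0 := h.Z_nonneg n i
    have z1 := h.Z_le_one n i
    have p0 := potential_nonneg (Z n i)
    have hq : 0 ≤ potential (Z n i) / √ρ ^ n := by positivity
    by_cases hp : √ρ ^ n ≤ potential (Z n i)
    · have : 1 ≤ potential (Z n i) / √ρ ^ n := by rwa [one_le_div hσn]
      have := h.I_le_one n i
      split_ifs <;> linarith
    · push Not at hp
      have hzz : Z n i * (1 - Z n i) ≤ ρ ^ n * ρ ^ n := by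
        rw [← sqrt_sqrt_pow_four (mul_nonneg z0 (sub_nonneg.2 z1)), ← hσσ]
        calc potential (Z n i) ^ 4 ≤ (√ρ ^ n) ^ 4 := pow_le_pow_left₀ p0 hp.le 4
          _ = _ := by ring
      split_ifs with hz
      · have := h.I_le_one n i
        linarith
      · push Not at hz
        have hz2 : 1 / 2 ≤ Z n i := by
          by_contra hcon
          push Not at hcon
          nlinarith
        have h4 := h.I_le n i
        have h5 : 1 - Z n i ≤ ε / 6 := by nlinarith
        linarith
  have h1 := h.sum_I n
  have h2 : ∑ i, I n i ≤ goodCount Z n (ρ ^ n) + (∑ i, potential (Z n i)) / √ρ ^ n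
      + 2 ^ n * (ε / 2) := by
    refine (Finset.sum_le_sum fun i _ => key i).trans_eq ?_
    simp [Finset.sum_add_distrib, goodCount, Finset.sum_div]
  have h3 : (∑ i, potential (Z n i)) / √ρ ^ n ≤ ε / 4 * 2 ^ n := by
    rw [div_le_iff₀ hσn]
    calc _ ≤ ρ ^ n * 2 ^ n := h.sum_potential n
      _ = √ρ ^ n * 2 ^ n * √ρ ^ n := by rw [← hσσ]; ring
      _ ≤ ε / 4 * 2 ^ n * √ρ ^ n := by gcongr
  have : 0 < (2 : ℝ) ^ n := by positivity
  nlinarith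

/-- Fast polarization: almost a fraction `I 0 0` of the indices has a Bhattacharyya parameter
of at most `4 ^ (-n)`. -/
theorem fast_polarization (h : IsPolarizing Z I) (ε : ℝ) (hε : 0 < ε) : ∃ n₀ : ℕ, ∀ n ≥ n₀,
    (I 0 0 - ε) * 2 ^ n ≤ (Finset.univ.filter fun i => Z n i ≤ ((4 : ℝ) ^ n)⁻¹).card := by
  obtain ⟨r, hr, hQ⟩ := h.exists_goodFraction
  have hiter : ∀ k : ℕ, GoodFraction Z (I 0 0) ((3 / 2) ^ k * r) := by
    intro k
    induction k with
    | zero => simpa using hQ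
    | succ k ih =>
      have := h.goodFraction_mul (by positivity) _ ih
      rwa [← mul_assoc, ← pow_succ'] at this
  -- Enough improvements by the factor `3/2` bring the exponent rate above 2, and `4 ^ (-n) = 2 ^
  -- (-2 n)`.
  obtain ⟨k, hk⟩ := pow_unbounded_of_one_lt (2 / r) (show (1 : ℝ) < 3 / 2 by norm_num)
  obtain ⟨n₀, hn₀⟩ := hiter k ε hε
  refine ⟨n₀, fun n hn => ?_⟩
  rw [← goodCount_eq_card]
  refine (hn₀ n hn).trans (goodCount_mono Z n ?_)
  rw [div_lt_iff₀ hr] at hk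
  rw [show (4 : ℝ) = 2 ^ (2 : ℝ) by norm_num, ← Real.rpow_mul_natCast (by norm_num),
    ← Real.rpow_neg (by norm_num)]
  apply Real.rpow_le_rpow_of_exponent_le (by norm_num)
  have : (0 : ℝ) ≤ n := by positivity
  nlinarith

end IsPolarizing

/-! ### Bhattacharyya parameter and mutual information of a binary-input kernel -/

/-- `f b` is a probability mass function for each input bit `b`. -/
structure IsKernel {O : Type*} (f : ZMod 2 → O → ℝ) : Prop where
  nonneg : ∀ b o, 0 ≤ f b o
  hasSum : ∀ b, HasSum (f b) 1

/-- The Bhattacharyya parameter. -/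
def bhatt {O : Type*} (f : ZMod 2 → O → ℝ) : ℝ := ∑' o, √(f 0 o * f 1 o)

/-- The contribution of an output with likelihoods `a`, `b` to the mutual information between
a uniform input bit and the output. -/
def infoTerm (a b : ℝ) : ℝ :=
  (a * Real.logb 2 (2 * a / (a + b)) + b * Real.logb 2 (2 * b / (a + b))) / 2

/-- The mutual information, in bits, between a uniform input bit and the output. -/
def info {O : Type*} (f : ZMod 2 → O → ℝ) : ℝ := ∑' o, infoTerm (f 0 o) (f 1 o)

/-- The worse of the two channels made from two uses of `f`. -/
def minus {O : Type*} (f : ZMod 2 → O → ℝ) (b : ZMod 2) (o : O × O) : ℝ :=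
  (∑ c, f (b + c) o.1 * f c o.2) / 2

/-- The better of the two channels made from two uses of `f`. -/
def plus {O : Type*} (f : ZMod 2 → O → ℝ) (b : ZMod 2) (o : (O × O) × ZMod 2) : ℝ :=
  f (o.2 + b) o.1.1 * f b o.1.2 / 2

theorem sum_zmod_two {M : Type*} [AddCommMonoid M] (g : ZMod 2 → M) : ∑ c, g c = g 0 + g 1 :=
  Fin.sum_univ_two g

theorem zmod_two_cases : ∀ c : ZMod 2, c = 0 ∨ c = 1 := by decide

theorem minus_zero {O : Type*} (f : ZMod 2 → O → ℝ) (o : O × O) :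
    minus f 0 o = (f 0 o.1 * f 0 o.2 + f 1 o.1 * f 1 o.2) / 2 := by
  simp [minus, sum_zmod_two]

theorem minus_one {O : Type*} (f : ZMod 2 → O → ℝ) (o : O × O) :
    minus f 1 o = (f 1 o.1 * f 0 o.2 + f 0 o.1 * f 1 o.2) / 2 := by
  simp [minus, sum_zmod_two, show (1 + 1 : ZMod 2) = 0 from rfl]

theorem bhatt_comp_equiv {O O' : Type*} (e : O' ≃ O) (f : ZMod 2 → O → ℝ) :
    bhatt (fun b o => f b (e o)) = bhatt f :=
  e.tsum_eq fun o => √(f 0 o * f 1 o)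

theorem info_comp_equiv {O O' : Type*} (e : O' ≃ O) (f : ZMod 2 → O → ℝ) :
    info (fun b o => f b (e o)) = info f :=
  e.tsum_eq fun o => infoTerm (f 0 o) (f 1 o)

theorem hasSum_ite_snd {α β : Type*} [DecidableEq β] {g : α × β → ℝ} (c : β) {r : ℝ}
    (hr : HasSum (fun a => g (a, c)) r) :
    HasSum (fun o : α × β => if o.2 = c then g o else 0) r := by
  have inj : Function.Injective fun a : α => (a, c) := fun a b hab => by simpa using hab
  rw [← inj.hasSum_iff]
  · simpa [Function.comp_def] using hr
  · rintro ⟨a, d⟩ hd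
    have : d ≠ c := fun h => hd ⟨a, by simp [h]⟩
    simp [this]

theorem hasSum_prod_zmod_two {α : Type*} {g : α × ZMod 2 → ℝ} {s t : ℝ}
    (hs : HasSum (fun a => g (a, 0)) s) (ht : HasSum (fun a => g (a, 1)) t) :
    HasSum g (s + t) := by
  convert (hasSum_ite_snd 0 hs).add (hasSum_ite_snd 1 ht) using 1
  funext ⟨a, c⟩
  rcases zmod_two_cases c with rfl | rfl <;> simp

theorem hasSum_mul_prod {α β : Type*} {f : α → ℝ} {g : β → ℝ} {s t : ℝ} (hf : HasSum f s)
    (hg : HasSum g t) : HasSum (fun o : α × β => f o.1 * g o.2) (s * t) :=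
  hf.mul hg (summable_mul_of_summable_norm hf.summable.norm hg.summable.norm)

namespace IsKernel

variable {O : Type*} {f : ZMod 2 → O → ℝ}

theorem hasSum_mean (hf : IsKernel f) : HasSum (fun o => (f 0 o + f 1 o) / 2) 1 := by
  simpa using ((hf.hasSum 0).add (hf.hasSum 1)).div_const 2

theorem sqrt_le_mean (hf : IsKernel f) (o : O) : √(f 0 o * f 1 o) ≤ (f 0 o + f 1 o) / 2 := by
  have h0 := hf.nonneg 0 o
  have h1 := hf.nonneg 1 o
  rw [Real.sqrt_le_left (by positivity)]
  nlinarith [sq_nonneg (f 0 o - f 1 o)]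

theorem hasSum_bhatt (hf : IsKernel f) : HasSum (fun o => √(f 0 o * f 1 o)) (bhatt f) :=
  (Summable.of_nonneg_of_le (fun _ => Real.sqrt_nonneg _) hf.sqrt_le_mean
    hf.hasSum_mean.summable).hasSum

theorem bhatt_nonneg (_ : IsKernel f) : 0 ≤ bhatt f := tsum_nonneg fun _ => Real.sqrt_nonneg _

theorem bhatt_le_one (hf : IsKernel f) : bhatt f ≤ 1 :=
  hasSum_le hf.sqrt_le_mean hf.hasSum_bhatt hf.hasSum_mean

theorem minus (hf : IsKernel f) : IsKernel (minus f) where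
  nonneg b o := div_nonneg (Finset.sum_nonneg fun c _ =>
    mul_nonneg (hf.nonneg _ _) (hf.nonneg _ _)) zero_le_two
  hasSum b := by
    have h := fun c => hasSum_mul_prod (hf.hasSum (b + c)) (hf.hasSum c)
    have := (hasSum_sum (s := Finset.univ) fun c _ => h c).div_const 2
    rw [show (∑ _c : ZMod 2, (1 : ℝ) * 1) / 2 = 1 by simp] at this
    exact this

theorem plus (hf : IsKernel f) : IsKernel (plus f) where
  nonneg b o := div_nonneg (mul_nonneg (hf.nonneg _ _) (hf.nonneg _ _)) zero_le_two
  hasSum b := by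
    have h := fun c : ZMod 2 => (hasSum_mul_prod (hf.hasSum (c + b)) (hf.hasSum b)).div_const 2
    have := hasSum_prod_zmod_two (g := NestedPolar.plus f b) (h 0) (h 1)
    convert this using 1
    norm_num

theorem bhatt_plus (hf : IsKernel f) : bhatt (NestedPolar.plus f) = bhatt f ^ 2 := by
  have h := (hasSum_mul_prod hf.hasSum_bhatt hf.hasSum_bhatt).div_const 2
  have key : ∀ (o : O × O) (c : ZMod 2),
      √(NestedPolar.plus f 0 (o, c) * NestedPolar.plus f 1 (o, c)) =
        √(f 0 o.1 * f 1 o.1) * √(f 0 o.2 * f 1 o.2) / 2 := by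
    intro o c
    have h0 := hf.nonneg 0 o.1
    have h1 := hf.nonneg 1 o.1
    have h2 := hf.nonneg 0 o.2
    have h3 := hf.nonneg 1 o.2
    rw [← Real.sqrt_mul (by positivity)]
    have : ∀ x : ℝ, 0 ≤ x → √x / 2 = √(x / 4) := fun x hx => by
      rw [Real.sqrt_div hx, show (4 : ℝ) = 2 ^ 2 by norm_num, Real.sqrt_sq (by norm_num)]
    rw [this _ (by positivity)]
    congr 1
    rcases zmod_two_cases c with rfl | rfl <;>
      simp [NestedPolar.plus, show (1 + 1 : ZMod 2) = 0 from rfl] <;> ring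
  have := hasSum_prod_zmod_two
    (g := fun o => √(NestedPolar.plus f 0 o * NestedPolar.plus f 1 o))
    (by simpa only [key] using h) (by simpa only [key] using h)
  rw [bhatt, this.tsum_eq]
  ring

/-- Pointwise, with `σ` the geometric and `p` the arithmetic mean of the two likelihoods, the
geometric mean for the worse channel is at most `σ₁ p₂ + p₁ σ₂`; each product sums to the
Bhattacharyya parameter. -/
theorem bhatt_minus_le (hf : IsKernel f) : bhatt (NestedPolar.minus f) ≤ 2 * bhatt f := by
  have hm := hf.hasSum_mean
  have hz := hf.hasSum_bhatt
  have h := (hasSum_mul_prod hz hm).add (hasSum_mul_prod hm hz)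
  refine (hasSum_le (fun o => ?_) hf.minus.hasSum_bhatt h).trans_eq (by ring)
  have h0 := hf.nonneg 0 o.1
  have h1 := hf.nonneg 1 o.1
  have h2 := hf.nonneg 0 o.2
  have h3 := hf.nonneg 1 o.2
  rw [Real.sqrt_le_left (by positivity), minus_zero, minus_one]
  have e1 := Real.sq_sqrt (mul_nonneg h0 h1)
  have e2 := Real.sq_sqrt (mul_nonneg h2 h3)
  set σ := √(f 0 o.1 * f 1 o.1)
  set τ := √(f 0 o.2 * f 1 o.2)
  have hσ : 0 ≤ σ := Real.sqrt_nonneg _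
  have hτ : 0 ≤ τ := Real.sqrt_nonneg _
  generalize f 0 o.1 = a at *
  generalize f 1 o.1 = b at *
  generalize f 0 o.2 = c at *
  generalize f 1 o.2 = d at *
  have e3 : (σ * ((c + d) / 2) + (a + b) / 2 * τ) ^ 2 =
      σ ^ 2 * (c + d) ^ 2 / 4 + τ ^ 2 * (a + b) ^ 2 / 4 + σ * τ * (a + b) * (c + d) / 2 := by ring
  rw [e3, e1, e2]
  have : 0 ≤ σ * τ * (a + b) * (c + d) / 2 := by positivity
  have : 0 ≤ a * b * c * d := by positivity
  nlinarith

/-- The Jensen inequality for the convex function `√(σ² u + v)`. -/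
theorem sqrt_le_tsum_sqrt {σ p : O → ℝ} {z u v : ℝ} (hσ : HasSum σ z) (hp : HasSum p 1)
    (hu : 0 ≤ u) (hv : 0 ≤ v) (hs : Summable fun o => √(σ o ^ 2 * u + p o ^ 2 * v)) :
    √(z ^ 2 * u + v) ≤ ∑' o, √(σ o ^ 2 * u + p o ^ 2 * v) := by
  rcases (show 0 ≤ z ^ 2 * u + v by positivity).eq_or_lt with h | h
  · rw [← h, Real.sqrt_zero]
    exact tsum_nonneg fun _ => Real.sqrt_nonneg _
  have hsq : 0 < √(z ^ 2 * u + v) := Real.sqrt_pos.2 h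
  have h1 := ((hσ.mul_right (z * u)).add (hp.mul_right v)).div_const √(z ^ 2 * u + v)
  have h2 : (z * (z * u) + 1 * v) / √(z ^ 2 * u + v) = √(z ^ 2 * u + v) := by
    rw [div_eq_iff hsq.ne', Real.mul_self_sqrt h.le]; ring
  rw [h2] at h1
  refine hasSum_le (fun o => ?_) h1 hs.hasSum
  rw [div_le_iff₀ hsq, ← Real.sqrt_mul (by positivity)]
  apply Real.le_sqrt_of_sq_le
  -- Cauchy–Schwarz: the gap in the squared inequality is exactly `u v (σ o - p o * z) ^ 2`.
  nlinarith [mul_nonneg (mul_nonneg hu hv) (sq_nonneg (σ o - p o * z))]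

/-- The squared geometric mean for the worse channel is a nonnegative quadratic form in `(σ₂, p₂)`
with coefficients depending on the first output. Jensen over the second output replaces `(σ₂, p₂)`
by `(z, 1)`; what remains has the same shape in `(σ₁, p₁)`, and Jensen over the first output gives
`√(z ^ 2 (1 - z ^ 2) + z ^ 2)`. -/
theorem le_bhatt_minus_sq (hf : IsKernel f) :
    bhatt f ^ 2 * (2 - bhatt f ^ 2) ≤ bhatt (NestedPolar.minus f) ^ 2 := by
  set z := bhatt f with hz
  have hz0 : 0 ≤ z := hf.bhatt_nonneg
  have hz1 : z ≤ 1 := hf.bhatt_le_one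
  set σ := fun o => √(f 0 o * f 1 o) with hσ
  set p := fun o => (f 0 o + f 1 o) / 2 with hp
  have hσp : ∀ o, σ o ≤ p o := hf.sqrt_le_mean
  have hσ0 : ∀ o, 0 ≤ σ o := fun o => Real.sqrt_nonneg _
  have term : ∀ o : O × O, √(NestedPolar.minus f 0 o * NestedPolar.minus f 1 o) =
      √(σ o.2 ^ 2 * (p o.1 ^ 2 - σ o.1 ^ 2) + p o.2 ^ 2 * σ o.1 ^ 2) := by
    intro o
    have e1 := Real.sq_sqrt (mul_nonneg (hf.nonneg 0 o.1) (hf.nonneg 1 o.1))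
    have e2 := Real.sq_sqrt (mul_nonneg (hf.nonneg 0 o.2) (hf.nonneg 1 o.2))
    congr 1
    rw [minus_zero, minus_one, hσ, hp]
    simp only [e1, e2]
    ring
  have hs := hf.minus.hasSum_bhatt.summable
  have hu : ∀ o, 0 ≤ p o ^ 2 - σ o ^ 2 := fun o => by nlinarith [hσp o, hσ0 o]
  have inner : ∀ o, √(σ o ^ 2 * (1 - z ^ 2) + p o ^ 2 * z ^ 2) ≤
      ∑' o', √(NestedPolar.minus f 0 (o, o') * NestedPolar.minus f 1 (o, o')) := by
    intro o
    have := sqrt_le_tsum_sqrt (u := p o ^ 2 - σ o ^ 2) (v := σ o ^ 2) hf.hasSum_bhatt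
      hf.hasSum_mean (hu o) (sq_nonneg _) (by
        have := hs.prod_factor o
        simpa only [term] using this)
    simp only [term]
    refine le_of_eq_of_le ?_ this
    congr 1; ring
  have hs2 := hs.prod
  have outer := sqrt_le_tsum_sqrt (u := 1 - z ^ 2) (v := z ^ 2) hf.hasSum_bhatt hf.hasSum_mean
    (by nlinarith) (sq_nonneg _)
    (Summable.of_nonneg_of_le (fun _ => Real.sqrt_nonneg _) inner hs2)
  have hle : √(z ^ 2 * (2 - z ^ 2)) ≤ bhatt (NestedPolar.minus f) := by
    calc √(z ^ 2 * (2 - z ^ 2)) = √(z ^ 2 * (1 - z ^ 2) + z ^ 2) := by congr 1; ring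
      _ ≤ _ := outer
      _ ≤ _ := Summable.tsum_le_tsum inner
        (Summable.of_nonneg_of_le (fun _ => Real.sqrt_nonneg _) inner hs2) hs2
      _ = _ := (hs.tsum_prod).symm
  calc z ^ 2 * (2 - z ^ 2) = √(z ^ 2 * (2 - z ^ 2)) ^ 2 :=
        (Real.sq_sqrt (mul_nonneg (sq_nonneg _) (by nlinarith))).symm
    _ ≤ _ := pow_le_pow_left₀ (Real.sqrt_nonneg _) hle 2

end IsKernel

/-! ### The chain rule and pointwise bounds for mutual information -/

theorem mul_log_two_mul_div {a s : ℝ} (ha : 0 ≤ a) (has : a ≤ s) :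
    a * Real.log (2 * a / s) = a * Real.log 2 - Real.negMulLog a - a * Real.log s := by
  rcases ha.eq_or_lt with rfl | ha
  · simp
  have hs : 0 < s := ha.trans_le has
  rw [Real.log_div (by positivity) hs.ne', Real.log_mul (by norm_num) ha.ne', Real.negMulLog]
  ring

/-- In terms of `Real.negMulLog` the formula needs no case distinction at zero likelihoods, and the
product rule for `negMulLog` becomes available. -/
theorem infoTerm_eq {a b : ℝ} (ha : 0 ≤ a) (hb : 0 ≤ b) :
    infoTerm a b = ((a + b) * Real.log 2 + Real.negMulLog (a + b) - Real.negMulLog a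
      - Real.negMulLog b) / (2 * Real.log 2) := by
  have hl : Real.log 2 ≠ 0 := (Real.log_pos (by norm_num)).ne'
  have h1 := mul_log_two_mul_div ha (le_add_of_nonneg_right hb)
  have h2 := mul_log_two_mul_div hb (le_add_of_nonneg_left ha)
  unfold infoTerm Real.logb
  rw [mul_div_assoc', mul_div_assoc', h1, h2, Real.negMulLog, Real.negMulLog, Real.negMulLog]
  field_simp
  ring

/-- The chain rule at one pair of outputs. The mixed likelihoods `(a c + b d) / 2` and `(b c + a d)
/ 2` enter the worse and the better channel with opposite signs and cancel; the other terms are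
entropies of products, which split. -/
theorem infoTerm_minus_add_plus {a b c d : ℝ} (ha : 0 ≤ a) (hb : 0 ≤ b) (hc : 0 ≤ c)
    (hd : 0 ≤ d) :
    infoTerm ((a * c + b * d) / 2) ((b * c + a * d) / 2) +
      (infoTerm (a * c / 2) (b * d / 2) + infoTerm (b * c / 2) (a * d / 2)) =
    infoTerm a b * ((c + d) / 2) + (a + b) / 2 * infoTerm c d := by
  have hl : Real.log 2 ≠ 0 := (Real.log_pos (by norm_num)).ne'
  rw [infoTerm_eq (by positivity) (by positivity), infoTerm_eq (by positivity) (by positivity),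
    infoTerm_eq (by positivity) (by positivity), infoTerm_eq ha hb, infoTerm_eq hc hd]
  have e1 : (a * c + b * d) / 2 + (b * c + a * d) / 2 = (a + b) * (c + d) * (1 / 2) := by ring
  have e2 : a * c / 2 + b * d / 2 = (a * c + b * d) / 2 := by ring
  have e3 : b * c / 2 + a * d / 2 = (b * c + a * d) / 2 := by ring
  have e4 : Real.negMulLog (1 / 2) = Real.log 2 / 2 := by
    rw [Real.negMulLog, one_div, Real.log_inv]; ring
  have e5 : ∀ x y : ℝ, x * y / 2 = x * y * (1 / 2) := fun x y => by ring
  rw [e1, e2, e3]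
  rw [e5 a c, e5 a d, e5 b c, e5 b d]
  simp only [Real.negMulLog_mul, e4]
  field_simp
  ring

theorem infoTerm_nonneg {a b : ℝ} (ha : 0 ≤ a) (hb : 0 ≤ b) : 0 ≤ infoTerm a b := by
  have hl : 0 < Real.log 2 := Real.log_pos (by norm_num)
  have key : ∀ x s : ℝ, 0 ≤ x → x ≤ s → (x - s / 2) / Real.log 2 ≤ x * Real.logb 2 (2 * x / s) := by
    intro x s hx hs
    rw [Real.logb, mul_div_assoc']
    gcongr
    rcases hx.eq_or_lt with rfl | hx
    · simp; linarith
    have hs' : 0 < s := hx.trans_le hs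
    have := Real.one_sub_inv_le_log_of_pos (show 0 < 2 * x / s by positivity)
    calc x - s / 2 = x * (1 - (2 * x / s)⁻¹) := by field_simp
      _ ≤ _ := by gcongr
  have h1 := key a (a + b) ha (by linarith)
  have h2 := key b (a + b) hb (by linarith)
  have h3 : (a - (a + b) / 2) / Real.log 2 + (b - (a + b) / 2) / Real.log 2 = 0 := by
    rw [← add_div]; ring
  unfold infoTerm
  linarith

theorem infoTerm_le {a b : ℝ} (ha : 0 ≤ a) (hb : 0 ≤ b) : infoTerm a b ≤ (a + b) / 2 := by
  have key : ∀ x s : ℝ, 0 ≤ x → x ≤ s → x * Real.logb 2 (2 * x / s) ≤ x := by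
    intro x s hx hs
    rcases hx.eq_or_lt with rfl | hx
    · simp
    have hs' : 0 < s := hx.trans_le hs
    have : Real.logb 2 (2 * x / s) ≤ 1 := by
      rw [Real.logb_le_iff_le_rpow (by norm_num) (by positivity), Real.rpow_one,
        div_le_iff₀ hs']
      linarith
    nlinarith
  have h1 := key a (a + b) ha (by linarith)
  have h2 := key b (a + b) hb (by linarith)
  unfold infoTerm
  linarith

/-- Since `log x ≤ x - 1`, the divergence is bounded by the chi-square term `(a - b) ^ 2 / (a + b)`,
which is at most four times the gap between the arithmetic and the geometric mean. The constant is
`2 / log 2 < 3`. -/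
theorem infoTerm_le_mean_sub_sqrt {a b : ℝ} (ha : 0 ≤ a) (hb : 0 ≤ b) :
    infoTerm a b ≤ 3 * ((a + b) / 2 - √(a * b)) := by
  have hl : 0 < Real.log 2 := Real.log_pos (by norm_num)
  have hl2 := Real.log_two_gt_d9
  have hsq := Real.sq_sqrt (mul_nonneg ha hb)
  have hσ := Real.sqrt_nonneg (a * b)
  set σ := √(a * b)
  rcases (add_nonneg ha hb).eq_or_lt with h | h
  · have h1 : a = 0 := by linarith
    have h2 : b = 0 := by linarith
    have h3 : σ = 0 := by simpa [h1] using hsq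
    simp [infoTerm, h1, h2, h3]
  have hσle : σ ≤ (a + b) / 2 := by
    apply le_of_sq_le_sq _ (by linarith)
    nlinarith [sq_nonneg (a - b)]
  have key : ∀ x : ℝ, 0 ≤ x → x * Real.log (2 * x / (a + b)) ≤ x * (2 * x / (a + b) - 1) := by
    intro x hx
    rcases hx.eq_or_lt with rfl | hx
    · simp
    have := Real.log_le_sub_one_of_pos (show 0 < 2 * x / (a + b) by positivity)
    gcongr
  have h1 := key a ha
  have h2 := key b hb
  have h3 : a * (2 * a / (a + b) - 1) + b * (2 * b / (a + b) - 1) = (a - b) ^ 2 / (a + b) := by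
    field_simp; ring
  have h4 : (a - b) ^ 2 / (a + b) ≤ 4 * ((a + b) / 2 - σ) := by
    rw [div_le_iff₀ h]
    nlinarith
  unfold infoTerm Real.logb
  rw [mul_div_assoc', mul_div_assoc', ← add_div, div_div, div_le_iff₀ (by positivity)]
  nlinarith

namespace IsKernel

variable {O : Type*} {f : ZMod 2 → O → ℝ}

theorem hasSum_info (hf : IsKernel f) :
    HasSum (fun o => infoTerm (f 0 o) (f 1 o)) (info f) :=
  (Summable.of_nonneg_of_le (fun _ => infoTerm_nonneg (hf.nonneg _ _) (hf.nonneg _ _))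
    (fun _ => infoTerm_le (hf.nonneg _ _) (hf.nonneg _ _)) hf.hasSum_mean.summable).hasSum

theorem info_le_one (hf : IsKernel f) : info f ≤ 1 :=
  hasSum_le (fun _ => infoTerm_le (hf.nonneg _ _) (hf.nonneg _ _)) hf.hasSum_info hf.hasSum_mean

theorem info_le_one_sub_bhatt (hf : IsKernel f) : info f ≤ 3 * (1 - bhatt f) :=
  hasSum_le (fun _ => infoTerm_le_mean_sub_sqrt (hf.nonneg _ _) (hf.nonneg _ _)) hf.hasSum_info
    ((hf.hasSum_mean.sub hf.hasSum_bhatt).mul_left 3)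

theorem info_minus_add_plus (hf : IsKernel f) :
    info (NestedPolar.minus f) + info (NestedPolar.plus f) = 2 * info f := by
  have h := (hasSum_mul_prod hf.hasSum_info hf.hasSum_mean).add
    (hasSum_mul_prod hf.hasSum_mean hf.hasSum_info)
  have hp : ∀ c : ZMod 2, Summable fun o : O × O =>
      infoTerm (NestedPolar.plus f 0 (o, c)) (NestedPolar.plus f 1 (o, c)) := fun c =>
    hf.plus.hasSum_info.summable.comp_injective (i := fun o : O × O => (o, c))
      (fun a b hab => by simpa using hab)
  have h2 := hf.minus.hasSum_info.add ((hp 0).hasSum.add (hp 1).hasSum)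
  have h3 := hf.plus.hasSum_info.unique
    (hasSum_prod_zmod_two (g := fun o => infoTerm (NestedPolar.plus f 0 o)
      (NestedPolar.plus f 1 o)) (hp 0).hasSum (hp 1).hasSum)
  rw [h3, two_mul, ← mul_one (info f)]
  nth_rewrite 2 [mul_comm]
  refine h2.unique ?_
  convert h using 1
  funext o
  rw [← infoTerm_minus_add_plus (hf.nonneg _ _) (hf.nonneg _ _) (hf.nonneg _ _) (hf.nonneg _ _),
    minus_zero, minus_one]
  simp [NestedPolar.plus, show (1 + 1 : ZMod 2) = 0 from rfl]

end IsKernel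

/-! ### The recursive structure of the polar transform -/

theorem bits_val (n : ℕ) (i : Fin (2 ^ n)) (k : Fin n) : (bits n i k : ℕ) = i / 2 ^ (k : ℕ) % 2 :=
  rfl

theorem generator_apply (n : ℕ) (i j : Fin (2 ^ n)) :
    generator n i j = ∏ k, kernelF (bits n i k.rev) (bits n j k) := by
  simp [generator, kroneckerPow, bitReversal, bits]

/-- The index `2 ^ n c + j`: position `j` in half `c`. -/
def half {n : ℕ} (c : Fin 2) (j : Fin (2 ^ n)) : Fin (2 ^ (n + 1)) :=
  ⟨j + 2 ^ n * c, by rw [pow_succ]; have := j.2; have := c.2; nlinarith⟩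

/-- An index is a position in one of the two halves. -/
def halfEquiv (n : ℕ) : Fin 2 × Fin (2 ^ n) ≃ Fin (2 ^ (n + 1)) :=
  finProdFinEquiv.trans (finCongr (by rw [pow_succ, mul_comm]))

theorem halfEquiv_apply {n : ℕ} (c : Fin 2) (j : Fin (2 ^ n)) : halfEquiv n (c, j) = half c j :=
  rfl

/-- An index is a child of a unique index of the previous level. -/
def childEquiv (n : ℕ) : Fin (2 ^ n) × Fin 2 ≃ Fin (2 ^ (n + 1)) := finProdFinEquiv

theorem childEquiv_symm_child {n : ℕ} (i : Fin (2 ^ n)) (b : Fin 2) :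
    (childEquiv n).symm (child i b) = (i, b) :=
  (childEquiv n).symm_apply_apply (i, b)

theorem exists_eq_child {n : ℕ} (j : Fin (2 ^ (n + 1))) : ∃ i b, j = child i b :=
  ⟨_, _, ((childEquiv n).apply_symm_apply j).symm⟩

theorem halfEquiv_symm_half {n : ℕ} (c : Fin 2) (j : Fin (2 ^ n)) :
    (halfEquiv n).symm (half c j) = (c, j) :=
  (halfEquiv n).symm_apply_apply (c, j)

theorem bits_half_castSucc {n : ℕ} (c : Fin 2) (j : Fin (2 ^ n)) (k : Fin n) :
    bits (n + 1) (half c j) k.castSucc = bits n j k := by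
  apply Fin.ext
  rw [bits_val, bits_val]
  simp only [half, Fin.val_castSucc]
  obtain ⟨d, hd⟩ : ∃ d, n = k + 1 + d := ⟨n - (k + 1), by have := k.2; omega⟩
  rw [show 2 ^ n * (c : ℕ) = 2 ^ (k : ℕ) * (2 * (2 ^ d * c)) by
    conv_lhs => rw [hd]
    ring, Nat.add_mul_div_left _ _ (by positivity), Nat.add_mul_mod_self_left]

theorem bits_half_last {n : ℕ} (c : Fin 2) (j : Fin (2 ^ n)) :
    bits (n + 1) (half c j) (Fin.last n) = c := by
  apply Fin.ext
  rw [bits_val]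
  simp only [half, Fin.val_last]
  rw [Nat.add_mul_div_left _ _ (by positivity), Nat.div_eq_of_lt j.2]
  have := c.2
  omega

theorem bits_child_zero {n : ℕ} (i : Fin (2 ^ n)) (b : Fin 2) :
    bits (n + 1) (child i b) 0 = b := by
  apply Fin.ext
  rw [bits_val, child_val]
  have := b.2
  simp
  omega

theorem bits_child_succ {n : ℕ} (i : Fin (2 ^ n)) (b : Fin 2) (k : Fin n) :
    bits (n + 1) (child i b) k.succ = bits n i k := by
  apply Fin.ext
  rw [bits_val, bits_val, child_val, Fin.val_succ, pow_succ', ← Nat.div_div_eq_div_mul]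
  congr 2
  have := b.2
  omega

/-- Bit reversal pairs the lowest digit of the row with the highest digit of the column. That is why
the tree grows by `2 i + b` in the rows while the columns split into two contiguous halves. -/
theorem generator_child_half {n : ℕ} (i j : Fin (2 ^ n)) (b c : Fin 2) :
    generator (n + 1) (child i b) (half c j) = generator n i j * kernelF b c := by
  rw [generator_apply, generator_apply, Fin.prod_univ_castSucc]
  simp only [Fin.rev_castSucc, bits_child_succ, bits_half_castSucc, Fin.rev_last, bits_child_zero,
    bits_half_last]

theorem vecMul_generator_half {n : ℕ} (u : Fin (2 ^ (n + 1)) → ZMod 2) (c : Fin 2)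
    (j : Fin (2 ^ n)) :
    Matrix.vecMul u (generator (n + 1)) (half c j) =
      Matrix.vecMul (fun i => u (child i 0) * kernelF 0 c + u (child i 1) * kernelF 1 c)
        (generator n) j := by
  simp only [Matrix.vecMul, dotProduct]
  rw [sum_child]
  refine Finset.sum_congr rfl fun i _ => ?_
  rw [generator_child_half, generator_child_half]
  ring

/-- The inputs of the two half-length transforms. -/
def splitInput (n : ℕ) : (Fin (2 ^ (n + 1)) → ZMod 2) ≃
    (Fin (2 ^ n) → ZMod 2) × (Fin (2 ^ n) → ZMod 2) where
  toFun u := (fun i => u (child i 0) + u (child i 1), fun i => u (child i 1))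
  invFun v j := if ((childEquiv n).symm j).2 = 0
    then v.1 ((childEquiv n).symm j).1 + v.2 ((childEquiv n).symm j).1
    else v.2 ((childEquiv n).symm j).1
  left_inv u := by
    funext j
    obtain ⟨i, b, rfl⟩ := exists_eq_child j
    simp only [childEquiv_symm_child]
    fin_cases b <;> simp [add_assoc, CharTwo.add_self_eq_zero]
  right_inv v := by
    ext i <;> simp [childEquiv_symm_child, add_assoc, CharTwo.add_self_eq_zero]

/-- The outputs of the two half-length transforms. -/
def splitOutput (Y : Type*) (n : ℕ) : (Fin (2 ^ (n + 1)) → Y) ≃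
    (Fin (2 ^ n) → Y) × (Fin (2 ^ n) → Y) where
  toFun y := (fun j => y (half 0 j), fun j => y (half 1 j))
  invFun v j := if ((halfEquiv n).symm j).1 = 0 then v.1 ((halfEquiv n).symm j).2
    else v.2 ((halfEquiv n).symm j).2
  left_inv y := by
    funext j
    obtain ⟨⟨c, i⟩, rfl⟩ := (halfEquiv n).surjective j
    simp only [halfEquiv_apply, halfEquiv_symm_half]
    fin_cases c <;> simp
  right_inv v := by
    ext i <;> simp [halfEquiv_symm_half]

/-- The vector channel with real values. -/
def vectorKernel {Y : Type*} {n : ℕ} (W : BinaryChannel Y) (u : Fin (2 ^ n) → ZMod 2)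
    (y : Fin (2 ^ n) → Y) : ℝ :=
  ∏ j, (W (Matrix.vecMul u (generator n) j) (y j)).toReal

theorem toReal_vectorChannel {Y : Type*} {n : ℕ} (W : BinaryChannel Y) (u : Fin (2 ^ n) → ZMod 2)
    (y : Fin (2 ^ n) → Y) : (vectorChannel W u y).toReal = vectorKernel W u y := by
  change (∏ j, W (Matrix.vecMul u (generator n) j) (y j)).toReal = _
  rw [ENNReal.toReal_prod]
  rfl

theorem vectorKernel_nonneg {Y : Type*} {n : ℕ} (W : BinaryChannel Y) (u : Fin (2 ^ n) → ZMod 2)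
    (y : Fin (2 ^ n) → Y) : 0 ≤ vectorKernel W u y :=
  Finset.prod_nonneg fun _ _ => ENNReal.toReal_nonneg

theorem vectorKernel_succ {Y : Type*} {n : ℕ} (W : BinaryChannel Y)
    (u : Fin (2 ^ (n + 1)) → ZMod 2) (y : Fin (2 ^ (n + 1)) → Y) :
    vectorKernel W u y =
      vectorKernel W (splitInput n u).1 (splitOutput Y n y).1 *
        vectorKernel W (splitInput n u).2 (splitOutput Y n y).2 := by
  unfold vectorKernel
  rw [← (halfEquiv n).prod_comp, Fintype.prod_prod_type, Fin.prod_univ_two]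
  simp only [halfEquiv_apply, vecMul_generator_half, splitInput, splitOutput, Equiv.coe_fn_mk]
  simp [kernelF]

/-! ### The recursion of the bit channels -/

/-- The outputs of the channel seen by bit `i`: the output word and the previous bits. -/
abbrev BitOutput (Y : Type*) {n : ℕ} (i : Fin (2 ^ n)) : Type _ :=
  (Fin (2 ^ n) → Y) × ({j : Fin (2 ^ n) // j < i} → ZMod 2)

/-- The channel seen by bit `i`, with real values. -/
def bitKernel {Y : Type*} {n : ℕ} (W : BinaryChannel Y) (i : Fin (2 ^ n)) (b : ZMod 2)
    (o : BitOutput Y i) : ℝ :=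
  (2 ^ (2 ^ n - 1))⁻¹ * ∑ v : Fin (2 ^ n) → ZMod 2,
    if (∀ j, v j.1 = o.2 j) ∧ v i = b then vectorKernel W v o.1 else 0

theorem toReal_bitChannel {Y : Type*} {n : ℕ} (W : BinaryChannel Y) (i : Fin (2 ^ n))
    (y : Fin (2 ^ n) → Y) (past : {j : Fin (2 ^ n) // j < i} → ZMod 2) (b : ZMod 2) :
    (bitChannel W i y past b).toReal = bitKernel W i b (y, past) := by
  unfold bitChannel bitKernel
  rw [ENNReal.toReal_sum, Finset.sum_filter, Finset.mul_sum]
  · refine Finset.sum_congr rfl fun v _ => ?_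
    rw [mul_ite, mul_zero, ENNReal.toReal_mul, toReal_vectorChannel]
    simp
  · intro v _
    exact ENNReal.mul_ne_top (by simp) (PMF.apply_ne_top _ _)

theorem bitChannel_ne_top {Y : Type*} {n : ℕ} (W : BinaryChannel Y) (i : Fin (2 ^ n))
    (y : Fin (2 ^ n) → Y) (past : {j : Fin (2 ^ n) // j < i} → ZMod 2) (b : ZMod 2) :
    bitChannel W i y past b ≠ ⊤ := by
  unfold bitChannel
  exact ENNReal.sum_ne_top.2 fun v _ => ENNReal.mul_ne_top (by simp) (PMF.apply_ne_top _ _)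

theorem child_lt_child_zero {n : ℕ} {i j : Fin (2 ^ n)} {b : Fin 2} :
    child j b < child i 0 ↔ j < i := by
  rw [Fin.lt_def, Fin.lt_def, child_val, child_val]
  have := b.2
  simp
  omega

theorem child_lt_child_one {n : ℕ} {i j : Fin (2 ^ n)} {b : Fin 2} :
    child j b < child i 1 ↔ j < i ∨ (j = i ∧ b = 0) := by
  rw [Fin.lt_def, Fin.lt_def, child_val, child_val, Fin.ext_iff, Fin.ext_iff]
  have := b.2
  simp
  omega

/-- The previous bits of a first child, in terms of the previous bits of its parent in the two
half-length transforms. -/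
def splitPastMinus {n : ℕ} (i : Fin (2 ^ n)) : ({j // j < child i 0} → ZMod 2) ≃
    ({j // j < i} → ZMod 2) × ({j // j < i} → ZMod 2) where
  toFun p := (fun j => p ⟨child j.1 0, child_lt_child_zero.2 j.2⟩ +
      p ⟨child j.1 1, child_lt_child_zero.2 j.2⟩,
    fun j => p ⟨child j.1 1, child_lt_child_zero.2 j.2⟩)
  invFun v j :=
    have hj : ((childEquiv n).symm j.1).1 < i := by
      obtain ⟨k, b, hk⟩ := exists_eq_child j.1
      rw [hk, childEquiv_symm_child]
      exact child_lt_child_zero.1 (hk ▸ j.2)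
    if ((childEquiv n).symm j.1).2 = 0 then v.1 ⟨_, hj⟩ + v.2 ⟨_, hj⟩ else v.2 ⟨_, hj⟩
  left_inv p := by
    funext ⟨j, hj⟩
    obtain ⟨k, b, rfl⟩ := exists_eq_child j
    simp only [childEquiv_symm_child]
    fin_cases b <;> simp [add_assoc, CharTwo.add_self_eq_zero]
  right_inv v := by
    ext i <;> simp [childEquiv_symm_child, add_assoc, CharTwo.add_self_eq_zero]

/-- The previous bits of a second child, in terms of the previous bits of its parent in the two
half-length transforms and of its sibling. -/
def splitPastPlus {n : ℕ} (i : Fin (2 ^ n)) : ({j // j < child i 1} → ZMod 2) ≃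
    (({j // j < i} → ZMod 2) × ({j // j < i} → ZMod 2)) × ZMod 2 where
  toFun p := ((fun j => p ⟨child j.1 0, child_lt_child_one.2 (.inl j.2)⟩ +
      p ⟨child j.1 1, child_lt_child_one.2 (.inl j.2)⟩,
    fun j => p ⟨child j.1 1, child_lt_child_one.2 (.inl j.2)⟩),
    p ⟨child i 0, child_lt_child_one.2 (.inr ⟨rfl, rfl⟩)⟩)
  invFun v j :=
    if hj : ((childEquiv n).symm j.1).1 < i then
      if ((childEquiv n).symm j.1).2 = 0 then v.1.1 ⟨_, hj⟩ + v.1.2 ⟨_, hj⟩ else v.1.2 ⟨_, hj⟩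
    else v.2
  left_inv p := by
    funext ⟨j, hj⟩
    obtain ⟨k, b, rfl⟩ := exists_eq_child j
    simp only [childEquiv_symm_child]
    rcases child_lt_child_one.1 hj with h | ⟨rfl, rfl⟩
    · rw [dif_pos h]
      fin_cases b <;> simp [add_assoc, CharTwo.add_self_eq_zero]
    · simp
  right_inv v := by
    ext k
    · have hk := k.2
      simp [childEquiv_symm_child, hk, add_assoc, CharTwo.add_self_eq_zero]
    · have hk := k.2
      simp [childEquiv_symm_child, hk]
    · simp [childEquiv_symm_child]

theorem extends_minus_iff {n : ℕ} (i : Fin (2 ^ n)) (v : Fin (2 ^ (n + 1)) → ZMod 2)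
    (p : {j // j < child i 0} → ZMod 2) :
    (∀ j, v j.1 = p j) ↔ (∀ j : {j // j < i}, (splitInput n v).1 j.1 = (splitPastMinus i p).1 j) ∧
      ∀ j : {j // j < i}, (splitInput n v).2 j.1 = (splitPastMinus i p).2 j := by
  constructor
  · intro h
    simp only [splitInput, splitPastMinus, Equiv.coe_fn_mk]
    exact ⟨fun j => by rw [← h, ← h], fun j => by rw [← h]⟩
  · rintro ⟨h1, h2⟩
    simp only [splitInput, splitPastMinus, Equiv.coe_fn_mk] at h1 h2
    rintro ⟨j, hj⟩
    obtain ⟨k, b, rfl⟩ := exists_eq_child j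
    have hk := child_lt_child_zero.1 hj
    have e1 := h1 ⟨k, hk⟩
    have e2 := h2 ⟨k, hk⟩
    fin_cases b
    · rw [e2] at e1; exact add_right_cancel e1
    · exact e2

theorem extends_plus_iff {n : ℕ} (i : Fin (2 ^ n)) (v : Fin (2 ^ (n + 1)) → ZMod 2)
    (p : {j // j < child i 1} → ZMod 2) :
    (∀ j, v j.1 = p j) ↔
      (∀ j : {j // j < i}, (splitInput n v).1 j.1 = (splitPastPlus i p).1.1 j) ∧
      (∀ j : {j // j < i}, (splitInput n v).2 j.1 = (splitPastPlus i p).1.2 j) ∧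
      (splitInput n v).1 i + (splitInput n v).2 i = (splitPastPlus i p).2 := by
  constructor
  · intro h
    simp only [splitInput, splitPastPlus, Equiv.coe_fn_mk]
    refine ⟨fun j => by rw [← h, ← h], fun j => by rw [← h], ?_⟩
    rw [← h, add_assoc, CharTwo.add_self_eq_zero, add_zero]
  · rintro ⟨h1, h2, h3⟩
    simp only [splitInput, splitPastPlus, Equiv.coe_fn_mk] at h1 h2 h3
    rw [add_assoc, CharTwo.add_self_eq_zero, add_zero] at h3
    rintro ⟨j, hj⟩
    obtain ⟨k, b, rfl⟩ := exists_eq_child j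
    rcases child_lt_child_one.1 hj with hk | ⟨rfl, rfl⟩
    · have e1 := h1 ⟨k, hk⟩
      have e2 := h2 ⟨k, hk⟩
      fin_cases b
      · rw [e2] at e1; exact add_right_cancel e1
      · exact e2
    · exact h3

/-- The outputs of a first child. -/
def splitMinus (Y : Type*) {n : ℕ} (i : Fin (2 ^ n)) :
    BitOutput Y (child i 0) ≃ BitOutput Y i × BitOutput Y i :=
  ((splitOutput Y n).prodCongr (splitPastMinus i)).trans (Equiv.prodProdProdComm _ _ _ _)

/-- The outputs of a second child. -/
def splitPlus (Y : Type*) {n : ℕ} (i : Fin (2 ^ n)) :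
    BitOutput Y (child i 1) ≃ (BitOutput Y i × BitOutput Y i) × ZMod 2 :=
  ((splitOutput Y n).prodCongr (splitPastPlus i)).trans
    ((Equiv.prodAssoc _ _ _).symm.trans
      ((Equiv.prodProdProdComm _ _ _ _).prodCongr (Equiv.refl _)))

theorem inv_two_pow_succ (n : ℕ) :
    ((2 : ℝ) ^ (2 ^ (n + 1) - 1))⁻¹ =
      (2 ^ (2 ^ n - 1))⁻¹ * (2 ^ (2 ^ n - 1))⁻¹ / 2 := by
  have : 2 ^ (n + 1) - 1 = (2 ^ n - 1) + (2 ^ n - 1) + 1 := by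
    have : 0 < 2 ^ n := by positivity
    rw [pow_succ]; omega
  rw [this, pow_succ, pow_add, mul_inv, mul_inv]
  ring

/-- The first of the two bits is the sum of the bits of the half-length inputs. Fixing it to `b`
leaves the second bit `c` free, and for each `c` the sum factors. -/
theorem sum_pair_minus {A : Type*} [Fintype A] (p q : A → Prop) [DecidablePred p]
    [DecidablePred q] (x : A → ZMod 2) (g h : A → ℝ) (b : ZMod 2) :
    (∑ v : A × A, if (p v.1 ∧ q v.2) ∧ x v.1 + x v.2 = b then g v.1 * h v.2 else 0) =
      ∑ c, (∑ a, if p a ∧ x a = b + c then g a else 0) * ∑ a, if q a ∧ x a = c then h a else 0 := by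
  simp only [Finset.sum_mul_sum]
  rw [Finset.sum_comm, Fintype.sum_prod_type]
  refine Finset.sum_congr rfl fun a _ => ?_
  rw [Finset.sum_comm]
  refine Finset.sum_congr rfl fun a' _ => ?_
  rw [sum_zmod_two]
  have h11 : (1 + 1 : ZMod 2) = 0 := rfl
  by_cases hp : p a <;> by_cases hq : q a' <;> simp only [hp, hq] <;>
    rcases zmod_two_cases (x a) with h1 | h1 <;> rcases zmod_two_cases (x a') with h2 | h2 <;>
    rcases zmod_two_cases b with rfl | rfl <;> simp [h1, h2, h11]

theorem sum_pair_plus {A : Type*} [Fintype A] (p q : A → Prop) [DecidablePred p]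
    [DecidablePred q] (x : A → ZMod 2) (g h : A → ℝ) (b c : ZMod 2) :
    (∑ v : A × A, if (p v.1 ∧ q v.2 ∧ x v.1 + x v.2 = c) ∧ x v.2 = b
      then g v.1 * h v.2 else 0) =
      (∑ a, if p a ∧ x a = c + b then g a else 0) * ∑ a, if q a ∧ x a = b then h a else 0 := by
  rw [Finset.sum_mul_sum, Fintype.sum_prod_type]
  refine Finset.sum_congr rfl fun a _ => Finset.sum_congr rfl fun a' _ => ?_
  have h11 : (1 + 1 : ZMod 2) = 0 := rfl
  by_cases hp : p a <;> by_cases hq : q a' <;> simp only [hp, hq] <;>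
    rcases zmod_two_cases (x a) with h1 | h1 <;> rcases zmod_two_cases (x a') with h2 | h2 <;>
    rcases zmod_two_cases b with rfl | rfl <;> rcases zmod_two_cases c with rfl | rfl <;>
    simp [h1, h2, h11]

theorem splitInput_add {n : ℕ} (v : Fin (2 ^ (n + 1)) → ZMod 2) (i : Fin (2 ^ n)) :
    (splitInput n v).1 i + (splitInput n v).2 i = v (child i 0) := by
  simp [splitInput, add_assoc, CharTwo.add_self_eq_zero]

theorem splitInput_snd {n : ℕ} (v : Fin (2 ^ (n + 1)) → ZMod 2) (i : Fin (2 ^ n)) :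
    (splitInput n v).2 i = v (child i 1) := rfl

theorem bitKernel_child_zero {Y : Type*} {n : ℕ} (W : BinaryChannel Y) (i : Fin (2 ^ n)) :
    bitKernel W (child i 0) = fun b o => minus (bitKernel W i) b (splitMinus Y i o) := by
  funext b ⟨y, p⟩
  have h := sum_pair_minus
    (fun v : Fin (2 ^ n) → ZMod 2 => ∀ j : {j // j < i}, v j.1 = (splitPastMinus i p).1 j)
    (fun v => ∀ j : {j // j < i}, v j.1 = (splitPastMinus i p).2 j)
    (fun v => v i) (fun v => vectorKernel W v (splitOutput Y n y).1)
    (fun v => vectorKernel W v (splitOutput Y n y).2) b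
  rw [← (splitInput n).sum_comp] at h
  simp only [← vectorKernel_succ, ← extends_minus_iff, splitInput_add] at h
  unfold bitKernel
  simp only [minus]
  rw [h, inv_two_pow_succ, div_mul_eq_mul_div, Finset.mul_sum]
  congr 1
  refine Finset.sum_congr rfl fun c _ => ?_
  rw [mul_mul_mul_comm]
  rfl

theorem bitKernel_child_one {Y : Type*} {n : ℕ} (W : BinaryChannel Y) (i : Fin (2 ^ n)) :
    bitKernel W (child i 1) = fun b o => plus (bitKernel W i) b (splitPlus Y i o) := by
  funext b ⟨y, p⟩
  have h := sum_pair_plus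
    (fun v : Fin (2 ^ n) → ZMod 2 => ∀ j : {j // j < i}, v j.1 = (splitPastPlus i p).1.1 j)
    (fun v => ∀ j : {j // j < i}, v j.1 = (splitPastPlus i p).1.2 j)
    (fun v => v i) (fun v => vectorKernel W v (splitOutput Y n y).1)
    (fun v => vectorKernel W v (splitOutput Y n y).2) b (splitPastPlus i p).2
  rw [← (splitInput n).sum_comp] at h
  simp only [← vectorKernel_succ, ← extends_plus_iff] at h
  simp only [splitInput_snd] at h
  unfold bitKernel
  simp only [plus]
  refine (congrArg _ ((Finset.sum_congr rfl fun v _ => if_congr Iff.rfl rfl rfl).trans h)).trans ?_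
  rw [inv_two_pow_succ, div_mul_eq_mul_div]
  congr 1
  rw [mul_mul_mul_comm]
  rfl

theorem IsKernel.comp_equiv {O O' : Type*} {f : ZMod 2 → O → ℝ} (hf : IsKernel f) (e : O' ≃ O) :
    IsKernel fun b o => f b (e o) :=
  ⟨fun b o => hf.nonneg b (e o), fun b => e.hasSum_iff.2 (hf.hasSum b)⟩

/-- The transition probabilities of `W` as real numbers. -/
def realKernel {Y : Type*} (W : BinaryChannel Y) (b : ZMod 2) (y : Y) : ℝ := (W b y).toReal

theorem hasSum_toReal_pmf {α : Type*} (p : PMF α) : HasSum (fun a => (p a).toReal) 1 := by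
  have := ENNReal.hasSum_toReal (f := p) (by simp [PMF.tsum_coe])
  rwa [← ENNReal.tsum_toReal_eq (fun y => PMF.apply_ne_top _ _), PMF.tsum_coe,
    ENNReal.toReal_one] at this

theorem isKernel_realKernel {Y : Type*} (W : BinaryChannel Y) : IsKernel (realKernel W) :=
  ⟨fun _ _ => ENNReal.toReal_nonneg, fun b => hasSum_toReal_pmf (W b)⟩

/-- The outputs of the bit channel of the trivial transform. -/
def bitOutputZero (Y : Type*) : BitOutput Y (0 : Fin (2 ^ 0)) ≃ Y where
  toFun o := o.1 0
  invFun y := (fun _ => y, fun j => absurd j.2 (Nat.not_lt_zero _))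
  left_inv o := Prod.ext (funext fun _ => congrArg o.1 (Subsingleton.elim (α := Fin 1) _ _))
    (funext fun j => absurd j.2 (Nat.not_lt_zero _))
  right_inv _ := rfl

theorem bitKernel_zero {Y : Type*} (W : BinaryChannel Y) :
    bitKernel W (0 : Fin (2 ^ 0)) = fun b o => realKernel W b (bitOutputZero Y o) := by
  funext b ⟨y, p⟩
  have key : ∀ v : Fin (2 ^ 0) → ZMod 2, vectorKernel W v y = (W (v 0) (y 0)).toReal := by
    intro v
    unfold vectorKernel
    refine (Fin.prod_univ_one _).trans ?_
    congr 2
    refine congrArg W ?_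
    simp only [Matrix.vecMul, dotProduct, generator_apply]
    refine (Fin.sum_univ_one (M := ZMod 2) _).trans ?_
    simp
  unfold bitKernel
  rw [Finset.sum_eq_single (fun _ => b)]
  · rw [if_pos ⟨fun j => absurd j.2 (Nat.not_lt_zero _), rfl⟩, key]
    simp [realKernel, bitOutputZero]
  · intro v _ hv
    rw [if_neg]
    rintro ⟨-, h⟩
    exact hv (funext fun j => by rw [← h]; exact congrArg v (Subsingleton.elim (α := Fin 1) _ _))
  · simp

theorem isKernel_bitKernel {Y : Type*} (W : BinaryChannel Y) :
    ∀ {n : ℕ} (i : Fin (2 ^ n)), IsKernel (bitKernel W i)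
  | 0, i => by
    obtain rfl : i = 0 := Subsingleton.elim (α := Fin 1) _ _
    rw [bitKernel_zero]
    exact (isKernel_realKernel W).comp_equiv _
  | n + 1, j => by
    obtain ⟨i, b, rfl⟩ := exists_eq_child j
    obtain rfl | rfl : b = 0 ∨ b = 1 := by omega
    · rw [bitKernel_child_zero]
      exact (isKernel_bitKernel W i).minus.comp_equiv _
    · rw [bitKernel_child_one]
      exact (isKernel_bitKernel W i).plus.comp_equiv _

/-- The bit channels polarize. -/
theorem isPolarizing_bitKernel {Y : Type*} (W : BinaryChannel Y) :
    IsPolarizing (fun n (i : Fin (2 ^ n)) => bhatt (bitKernel W i))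
      (fun n (i : Fin (2 ^ n)) => info (bitKernel W i)) where
  Z_nonneg _ i := (isKernel_bitKernel W i).bhatt_nonneg
  Z_le_one _ i := (isKernel_bitKernel W i).bhatt_le_one
  Z_plus _ i := by
    rw [bitKernel_child_one, bhatt_comp_equiv, (isKernel_bitKernel W i).bhatt_plus]
  Z_minus_le _ i := by
    rw [bitKernel_child_zero, bhatt_comp_equiv]
    exact (isKernel_bitKernel W i).bhatt_minus_le
  le_Z_minus_sq _ i := by
    rw [bitKernel_child_zero, bhatt_comp_equiv]
    exact (isKernel_bitKernel W i).le_bhatt_minus_sq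
  I_le_one _ i := (isKernel_bitKernel W i).info_le_one
  I_le_add _ i := by
    rw [bitKernel_child_zero, bitKernel_child_one, info_comp_equiv, info_comp_equiv,
      (isKernel_bitKernel W i).info_minus_add_plus]
  I_le _ i := (isKernel_bitKernel W i).info_le_one_sub_bhatt

/-- Almost a fraction `info W` of the bit channels has a Bhattacharyya parameter of at most
`4 ^ (-n)`. -/
theorem exists_card_good_ge {Y : Type*} (W : BinaryChannel Y) (ε : ℝ) (hε : 0 < ε) :
    ∃ n₀ : ℕ, ∀ n ≥ n₀, (info (realKernel W) - ε) * 2 ^ n ≤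
      (Finset.univ.filter fun i : Fin (2 ^ n) => bhatt (bitKernel W i) ≤ ((4 : ℝ) ^ n)⁻¹).card := by
  have h := (isPolarizing_bitKernel W).fast_polarization ε hε
  rwa [bitKernel_zero, info_comp_equiv] at h

/-! ### Symmetric channels -/

theorem IsSymmetric.exists_flip {Y : Type*} {W : BinaryChannel Y} (hW : IsSymmetric W) :
    ∃ φ : ZMod 2 → Equiv.Perm Y, ∀ b c y, W (b + c) y = W b (φ c y) := by
  obtain ⟨π, hπ, h⟩ := hW
  refine ⟨fun c => if c = 0 then Equiv.refl Y else π, fun b c y => ?_⟩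
  rcases zmod_two_cases c with rfl | rfl
  · simp
  · rcases zmod_two_cases b with rfl | rfl
    · simp [h]
    · simp [show (1 + 1 : ZMod 2) = 0 from rfl, h, hπ y]

/-- Adding `v` to the input of the polar transform permutes the outputs. -/
theorem IsSymmetric.exists_shift {Y : Type*} {W : BinaryChannel Y} (hW : IsSymmetric W) {n : ℕ}
    (v : Fin (2 ^ n) → ZMod 2) : ∃ σ : Equiv.Perm (Fin (2 ^ n) → Y),
      ∀ u y, vectorKernel W (u + v) y = vectorKernel W u (σ y) := by
  obtain ⟨φ, hφ⟩ := hW.exists_flip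
  refine ⟨Equiv.piCongrRight fun j => φ (Matrix.vecMul v (generator n) j), fun u y => ?_⟩
  unfold vectorKernel
  refine Finset.prod_congr rfl fun j _ => ?_
  rw [Matrix.add_vecMul, Pi.add_apply, hφ]
  rfl

/-- Translating the summation variable by `v` moves the shift from the past and the current bit onto
the output word. -/
theorem bitKernel_shift {Y : Type*} {W : BinaryChannel Y} {n : ℕ} {v : Fin (2 ^ n) → ZMod 2}
    {σ : Equiv.Perm (Fin (2 ^ n) → Y)}
    (hσ : ∀ u y, vectorKernel W (u + v) y = vectorKernel W u (σ y)) (i : Fin (2 ^ n)) (b : ZMod 2)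
    (y : Fin (2 ^ n) → Y) (p : {j // j < i} → ZMod 2) :
    bitKernel W i (b + v i) (y, fun j => p j + v j.1) = bitKernel W i b (σ y, p) := by
  unfold bitKernel
  rw [← Equiv.sum_comp (Equiv.addRight v)]
  simp only [Equiv.coe_addRight, hσ, Pi.add_apply, add_left_inj]

/-! ### Error events of successive cancellation -/

/-- Given the correct previous bits, the wrong value of bit `i` is at least as likely as the
correct one. -/
def ErrorEvent {Y : Type*} {n : ℕ} (W : BinaryChannel Y) (i : Fin (2 ^ n))
    (u : Fin (2 ^ n) → ZMod 2) : Set (Fin (2 ^ n) → Y) :=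
  {y | bitKernel W i (u i) (y, fun j => u j.1) ≤ bitKernel W i (u i + 1) (y, fun j => u j.1)}

theorem hasSum_vectorKernel {Y : Type*} {n : ℕ} (W : BinaryChannel Y)
    (u : Fin (2 ^ n) → ZMod 2) : HasSum (vectorKernel W u) 1 := by
  simpa only [toReal_vectorChannel] using hasSum_toReal_pmf (vectorChannel W u)

theorem summable_indicator_vectorKernel {Y : Type*} {n : ℕ} (W : BinaryChannel Y)
    (u : Fin (2 ^ n) → ZMod 2) (s : Set (Fin (2 ^ n) → Y)) :
    Summable (s.indicator (vectorKernel W u)) :=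
  (hasSum_vectorKernel W u).summable.indicator s

theorem sum_eq_sum_extends {n : ℕ} (i : Fin (2 ^ n)) (h : (Fin (2 ^ n) → ZMod 2) → ℝ) :
    ∑ u, h u = ∑ p : {j // j < i} → ZMod 2, ∑ b, ∑ v : Fin (2 ^ n) → ZMod 2,
      if (∀ j, v j.1 = p j) ∧ v i = b then h v else 0 := by
  have : ∀ p : {j // j < i} → ZMod 2, (∑ b, ∑ v : Fin (2 ^ n) → ZMod 2,
      if (∀ j, v j.1 = p j) ∧ v i = b then h v else 0) =
      ∑ v : Fin (2 ^ n) → ZMod 2, if p = (fun j => v j.1) then h v else 0 := by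
    intro p
    rw [Finset.sum_comm]
    refine Finset.sum_congr rfl fun v _ => ?_
    simp only [ite_and, eq_comm (a := p), funext_iff]
    split_ifs <;> simp
  simp only [this]
  rw [Finset.sum_comm]
  simp

/-- Group the inputs by their past and the value `b` of bit `i`; membership of `y` in the error
event depends only on this group. Either the group contributes nothing, or the likelihood of `b` is
at most that of `b + 1` and hence at most their geometric mean. The two values of `b` turn the
normalization `2 ^ (N - 1)` into `2 ^ N`. -/
theorem indicator_errorEvent_sum_le {Y : Type*} {n : ℕ} (W : BinaryChannel Y) (i : Fin (2 ^ n))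
    (y : Fin (2 ^ n) → Y) :
    ∑ u, (ErrorEvent W i u).indicator (vectorKernel W u) y ≤
      2 ^ (2 ^ n) * ∑ p, √(bitKernel W i 0 (y, p) * bitKernel W i 1 (y, p)) := by
  classical
  have hpow : (2 : ℝ) ^ (2 ^ n) = 2 ^ (2 ^ n - 1) * 2 := by
    rw [← pow_succ, Nat.sub_add_cancel (Nat.one_le_two_pow)]
  rw [sum_eq_sum_extends i, Finset.mul_sum]
  refine Finset.sum_le_sum fun p _ => ?_
  have key : ∀ b, (∑ v : Fin (2 ^ n) → ZMod 2, if (∀ j, v j.1 = p j) ∧ v i = b then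
      (ErrorEvent W i v).indicator (vectorKernel W v) y else 0) ≤
      2 ^ (2 ^ n - 1) * √(bitKernel W i b (y, p) * bitKernel W i (b + 1) (y, p)) := by
    intro b
    have h0 := (isKernel_bitKernel W i).nonneg b (y, p)
    have h1 := (isKernel_bitKernel W i).nonneg (b + 1) (y, p)
    by_cases hb : bitKernel W i b (y, p) ≤ bitKernel W i (b + 1) (y, p)
    · calc _ ≤ ∑ v : Fin (2 ^ n) → ZMod 2, (if (∀ j, v j.1 = p j) ∧ v i = b then
            vectorKernel W v y else 0) := Finset.sum_le_sum fun v _ => by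
              split_ifs
              · exact Set.indicator_le_self' (fun _ _ => vectorKernel_nonneg _ _ _) _
              · exact le_rfl
        _ = 2 ^ (2 ^ n - 1) * bitKernel W i b (y, p) := by
              unfold bitKernel
              rw [mul_inv_cancel_left₀ (by positivity)]
        _ ≤ _ := by
              gcongr
              apply Real.le_sqrt_of_sq_le
              nlinarith
    · refine le_trans (Finset.sum_nonpos fun v _ => ?_) (by positivity)
      split_ifs with hv
      · rw [Set.indicator_of_notMem]
        intro hmem
        simp only [ErrorEvent, Set.mem_ofPred_eq, hv.2, hv.1] at hmem
        exact hb hmem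
      · exact le_rfl
  rw [sum_zmod_two]
  have k0 := key 0
  have k1 := key 1
  rw [show (1 + 1 : ZMod 2) = 0 from rfl, mul_comm (bitKernel W i 1 _)] at k1
  rw [zero_add] at k0
  rw [hpow]
  linarith

/-- For a symmetric channel, the probability of an error event is at most the Bhattacharyya
parameter of the bit channel, for every input. -/
theorem IsSymmetric.tsum_errorEvent_le {Y : Type*} {W : BinaryChannel Y} (hW : IsSymmetric W)
    {n : ℕ} (i : Fin (2 ^ n)) (u : Fin (2 ^ n) → ZMod 2) :
    ∑' y, (ErrorEvent W i u).indicator (vectorKernel W u) y ≤ bhatt (bitKernel W i) := by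
  classical
  -- By symmetry the error probability is the same for all inputs, so the bound on the average holds
  -- for each of them.
  have hconst : ∀ v : Fin (2 ^ n) → ZMod 2,
      ∑' y, (ErrorEvent W i v).indicator (vectorKernel W v) y =
        ∑' y, (ErrorEvent W i 0).indicator (vectorKernel W 0) y := by
    intro v
    obtain ⟨σ, hσ⟩ := hW.exists_shift v
    rw [← Equiv.tsum_eq σ ((ErrorEvent W i 0).indicator (vectorKernel W 0))]
    refine tsum_congr fun y => ?_
    have h1 : vectorKernel W v y = vectorKernel W 0 (σ y) := by rw [← hσ, zero_add]
    have h2 : y ∈ ErrorEvent W i v ↔ σ y ∈ ErrorEvent W i 0 := by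
      have e0 := bitKernel_shift hσ i 0 y 0
      have e1 := bitKernel_shift hσ i 1 y 0
      simp only [Pi.zero_apply, zero_add] at e0 e1
      simp only [ErrorEvent, Set.mem_ofPred_eq, Pi.zero_apply, zero_add]
      rw [e0, add_comm (v i), e1]
      rfl
    simp only [Set.indicator_apply, h1, h2]
  have hZ := (isKernel_bitKernel W i).hasSum_bhatt
  have hs : HasSum (fun y => ∑ u, (ErrorEvent W i u).indicator (vectorKernel W u) y)
      (∑ u : Fin (2 ^ n) → ZMod 2, ∑' y, (ErrorEvent W i u).indicator (vectorKernel W u) y) :=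
    hasSum_sum fun u _ => (summable_indicator_vectorKernel W u _).hasSum
  have hZ2 : HasSum (fun y => ∑ p, √(bitKernel W i 0 (y, p) * bitKernel W i 1 (y, p)))
      (bhatt (bitKernel W i)) :=
    hZ.prod_fiberwise fun y => hasSum_fintype _
  have := hasSum_le (indicator_errorEvent_sum_le W i) hs (hZ2.mul_left _)
  simp only [hconst] at this
  rw [hconst]
  simp only [Finset.sum_const, Finset.card_univ, Fintype.card_fun, ZMod.card, Fintype.card_fin,
    nsmul_eq_mul, Nat.cast_pow, Nat.cast_ofNat] at this
  exact le_of_mul_le_mul_left this (by positivity)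

/-! ### Successive cancellation decoding -/

/-- By strong induction the earlier decisions are correct, so the decoder compares likelihoods at
the true past. Ties belong to the error event, hence outside it the comparison is strict and the tie
rule plays no role. -/
theorem scDecode_eq {Y : Type*} {n : ℕ} (W : BinaryChannel Y) (A : Finset (Fin (2 ^ n)))
    (u : Fin (2 ^ n) → ZMod 2) (hu : ∀ i ∉ A, u i = 0) (y : Fin (2 ^ n) → Y)
    (hy : ∀ i ∈ A, y ∉ ErrorEvent W i u) : scDecode W A y = u := by
  have key : ∀ (k : ℕ) (i : Fin (2 ^ n)), i.val = k → scDecode W A y i = u i := by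
    intro k
    induction k using Nat.strong_induction_on with
    | _ k ih =>
      intro i hi
      have hpast : (fun j : {j // j < i} => scDecode W A y j.1) = fun j => u j.1 :=
        funext fun j => ih j.1.val (hi ▸ j.2) j.1 rfl
      rw [scDecode, hpast]
      by_cases hA : i ∈ A
      · have hne := hy i hA
        simp only [ErrorEvent, Set.mem_ofPred_eq, not_le] at hne
        have hcmp : bitChannel W i y (fun j => u j.1) 1 ≤ bitChannel W i y (fun j => u j.1) 0 ↔
            bitKernel W i 1 (y, fun j => u j.1) ≤ bitKernel W i 0 (y, fun j => u j.1) := by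
          rw [← ENNReal.toReal_le_toReal (bitChannel_ne_top _ _ _ _ _)
            (bitChannel_ne_top _ _ _ _ _), toReal_bitChannel, toReal_bitChannel]
        rcases zmod_two_cases (u i) with h | h
        · rw [h, zero_add] at hne
          rw [if_pos (Or.inr (hcmp.2 hne.le)), h]
        · rw [h, show (1 + 1 : ZMod 2) = 0 from rfl] at hne
          rw [if_neg, h]
          simp [hA, hcmp, hne]
      · rw [if_pos (Or.inl hA), hu i hA]
  exact funext fun i => key _ i rfl

theorem toOuterMeasure_vectorChannel {Y : Type*} {n : ℕ} (W : BinaryChannel Y)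
    (u : Fin (2 ^ n) → ZMod 2) (s : Set (Fin (2 ^ n) → Y)) :
    (vectorChannel W u).toOuterMeasure s =
      ENNReal.ofReal (∑' y, s.indicator (vectorKernel W u) y) := by
  rw [PMF.toOuterMeasure_apply, ENNReal.ofReal_tsum_of_nonneg
    (fun y => Set.indicator_nonneg (fun y _ => vectorKernel_nonneg W u y) y)
    (summable_indicator_vectorKernel W u s)]
  refine tsum_congr fun y => ?_
  by_cases h : y ∈ s
  · rw [Set.indicator_of_mem h, Set.indicator_of_mem h, ← toReal_vectorChannel,
      ENNReal.ofReal_toReal (PMF.apply_ne_top _ _)]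
  · simp [h]

namespace NestedPolarCode

variable {n : ℕ} (P : NestedPolarCode n)

theorem inputBits_of_notMem (s : P.Message) (t : P.Randomness) {i : Fin (2 ^ n)} (hi : i ∉ P.A) :
    P.inputBits s t i = 0 := by
  have h1 : i ∉ P.A \ P.B := fun h => hi (Finset.mem_sdiff.1 h).1
  have h2 : i ∉ P.B := fun h => hi (P.subset h)
  simp only [inputBits, dif_neg h1, dif_neg h2]

theorem inputBits_message (s : P.Message) (t : P.Randomness) (i : {i // i ∈ P.A \ P.B}) :
    P.inputBits s t i.1 = s i := by
  simp only [inputBits, dif_pos i.2]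

theorem inputBits_randomness (s : P.Message) (t : P.Randomness) (i : {i // i ∈ P.B}) :
    P.inputBits s t i.1 = t i := by
  have h1 : i.1 ∉ P.A \ P.B := fun h => (Finset.mem_sdiff.1 h).2 i.2
  simp only [inputBits, dif_neg h1, dif_pos i.2]

theorem messageErrorProb_le_blockErrorProb {Y : Type*} (W : BinaryChannel Y) :
    P.messageErrorProb W ≤ P.blockErrorProb W := by
  unfold messageErrorProb blockErrorProb
  refine ENNReal.toReal_mono ?_ (MeasureTheory.measure_mono fun ω hω h => hω ?_)
  · rw [PMF.toOuterMeasure_apply]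
    refine ((ENNReal.tsum_le_tsum fun ω => Set.indicator_le_self _ _ ω).trans_lt ?_).ne
    rw [PMF.tsum_coe]
    exact ENNReal.one_lt_top
  · funext i
    rw [decodeMessage, h, inputBits_message]

/-- A union bound over `A`, carried out for each fixed message and randomness and then averaged. -/
theorem blockErrorProb_le {Y : Type*} {W : BinaryChannel Y} (hW : IsSymmetric W) :
    P.blockErrorProb W ≤ ∑ i ∈ P.A, bhatt (bitKernel W i) := by
  have hpos : ∀ i ∈ P.A, 0 ≤ bhatt (bitKernel W i) := fun i _ =>
    (isKernel_bitKernel W i).bhatt_nonneg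
  refine ENNReal.toReal_le_of_le_ofReal (Finset.sum_nonneg hpos) ?_
  rw [law, PMF.toOuterMeasure_bind_apply]
  calc _ ≤ ∑' st, PMF.uniformOfFintype (P.Message × P.Randomness) st *
        ENNReal.ofReal (∑ i ∈ P.A, bhatt (bitKernel W i)) := by
        refine ENNReal.tsum_le_tsum fun st => mul_le_mul_right ?_ _
        rw [PMF.toOuterMeasure_map_apply]
        set u := P.inputBits st.1 st.2 with hu
        calc _ ≤ (vectorChannel W u).toOuterMeasure (⋃ i ∈ P.A, ErrorEvent W i u) := by
              refine MeasureTheory.measure_mono fun y hy => ?_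
              by_contra hcon
              simp only [Set.mem_iUnion, not_exists] at hcon
              exact hy (scDecode_eq W P.A u
                (fun i hi => P.inputBits_of_notMem st.1 st.2 hi) y fun i hi => hcon i hi)
          _ ≤ ∑ i ∈ P.A, (vectorChannel W u).toOuterMeasure (ErrorEvent W i u) :=
              MeasureTheory.measure_biUnion_finset_le _ _
          _ ≤ ∑ i ∈ P.A, ENNReal.ofReal (bhatt (bitKernel W i)) := by
              refine Finset.sum_le_sum fun i _ => ?_
              rw [toOuterMeasure_vectorChannel]
              exact ENNReal.ofReal_le_ofReal (hW.tsum_errorEvent_le i u)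
          _ = _ := (ENNReal.ofReal_sum_of_nonneg hpos).symm
    _ = _ := by rw [ENNReal.tsum_mul_right, PMF.tsum_coe, one_mul]

end NestedPolarCode

/-! ### Capacity of a symmetric channel -/

/-- Pointwise form of the Gibbs inequality. -/
theorem sub_div_log_two_le {q m : ℝ} (hq : 0 ≤ q) (hm : 0 ≤ m) (h : m = 0 → q = 0) :
    (q - m) / Real.log 2 ≤ q * Real.logb 2 (q / m) := by
  have hl : 0 < Real.log 2 := Real.log_pos (by norm_num)
  rw [Real.logb, mul_div_assoc']
  gcongr
  rcases hq.eq_or_lt with rfl | hq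
  · simpa using hm
  have hm : 0 < m := lt_of_le_of_ne hm fun h0 => hq.ne' (h h0.symm)
  have := Real.one_sub_inv_le_log_of_pos (div_pos hq hm)
  calc q - m = q * (1 - (q / m)⁻¹) := by field_simp
    _ ≤ _ := by gcongr

theorem mul_logb_div_eq_sub {w q m : ℝ} (h : w ≠ 0 → q ≠ 0 ∧ m ≠ 0) (c r : ℝ) (hw : w = c * r) :
    w * Real.logb 2 (r / q) = w * Real.logb 2 (r / m) - w * Real.logb 2 (q / m) := by
  by_cases h0 : w = 0
  · simp [h0]
  obtain ⟨hq, hm⟩ := h h0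
  have hr : r ≠ 0 := fun hr => h0 (by rw [hw, hr, mul_zero])
  rw [Real.logb_div hr hq, Real.logb_div hr hm, Real.logb_div hq hm]
  ring

/-- The output law under a uniform input. -/
def meanKernel {Y : Type*} (W : BinaryChannel Y) (y : Y) : ℝ :=
  (realKernel W 0 y + realKernel W 1 y) / 2

theorem realKernel_nonneg {Y : Type*} (W : BinaryChannel Y) (x : ZMod 2) (y : Y) :
    0 ≤ realKernel W x y := ENNReal.toReal_nonneg

theorem meanKernel_nonneg {Y : Type*} (W : BinaryChannel Y) (y : Y) : 0 ≤ meanKernel W y := by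
  have := realKernel_nonneg W 0 y
  have := realKernel_nonneg W 1 y
  unfold meanKernel
  positivity

theorem hasSum_meanKernel {Y : Type*} (W : BinaryChannel Y) : HasSum (meanKernel W) 1 :=
  (isKernel_realKernel W).hasSum_mean

theorem realKernel_le_two_mul_meanKernel {Y : Type*} (W : BinaryChannel Y) (x : ZMod 2) (y : Y) :
    realKernel W x y ≤ 2 * meanKernel W y := by
  have := realKernel_nonneg W 0 y
  have := realKernel_nonneg W 1 y
  unfold meanKernel
  rcases zmod_two_cases x with rfl | rfl <;> linarith

theorem realKernel_eq_zero {Y : Type*} {W : BinaryChannel Y} {y : Y} (h : meanKernel W y = 0)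
    (x : ZMod 2) : realKernel W x y = 0 :=
  le_antisymm (by simpa [h] using realKernel_le_two_mul_meanKernel W x y) (realKernel_nonneg W x y)

theorem infoTerm_realKernel {Y : Type*} (W : BinaryChannel Y) (y : Y) :
    infoTerm (realKernel W 0 y) (realKernel W 1 y) =
      (realKernel W 0 y * Real.logb 2 (realKernel W 0 y / meanKernel W y) +
        realKernel W 1 y * Real.logb 2 (realKernel W 1 y / meanKernel W y)) / 2 := by
  have : ∀ x, 2 * x / (realKernel W 0 y + realKernel W 1 y) = x / meanKernel W y := fun x => by
    rw [meanKernel, div_div_eq_mul_div, mul_comm]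
  rw [infoTerm, this, this]

/-- The terms can be negative and the alphabet infinite. Subtracting the summable Gibbs lower bound
makes them nonnegative, and since the likelihood ratio to the mean is at most 2 they are then
dominated. -/
theorem summable_divergence {Y : Type*} (W : BinaryChannel Y) (x : ZMod 2) :
    Summable fun y => realKernel W x y * Real.logb 2 (realKernel W x y / meanKernel W y) := by
  have hr := ((isKernel_realKernel W).hasSum x).summable
  have hm := (hasSum_meanKernel W).summable
  have h1 : Summable fun y => realKernel W x y * Real.logb 2 (realKernel W x y / meanKernel W y) -
      (realKernel W x y - meanKernel W y) / Real.log 2 := by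
    refine Summable.of_nonneg_of_le (fun y => ?_) (fun y => ?_)
      (hr.sub ((hr.sub hm).div_const (Real.log 2)))
    · exact sub_nonneg.2 (sub_div_log_two_le (realKernel_nonneg _ _ _) (meanKernel_nonneg _ _)
        fun h => realKernel_eq_zero h x)
    · gcongr
      have h0 := realKernel_nonneg W x y
      rcases h0.eq_or_lt with h0 | h0
      · simp [← h0]
      have h2 := realKernel_le_two_mul_meanKernel W x y
      have hm0 : 0 < meanKernel W y := by linarith
      have : Real.logb 2 (realKernel W x y / meanKernel W y) ≤ 1 := by
        rw [Real.logb_le_iff_le_rpow (by norm_num) (by positivity), Real.rpow_one,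
          div_le_iff₀ hm0]
        exact h2
      nlinarith
  simpa using h1.add ((hr.sub hm).div_const (Real.log 2))

/-- For a symmetric channel, each input has the same divergence from the mean output law. -/
theorem IsSymmetric.hasSum_divergence {Y : Type*} {W : BinaryChannel Y} (hW : IsSymmetric W)
    (x : ZMod 2) :
    HasSum (fun y => realKernel W x y * Real.logb 2 (realKernel W x y / meanKernel W y))
      (info (realKernel W)) := by
  set D : ZMod 2 → ℝ := fun x =>
    ∑' y, realKernel W x y * Real.logb 2 (realKernel W x y / meanKernel W y) with hD
  have h1 : D 1 = D 0 := by
    obtain ⟨φ, hφ⟩ := hW.exists_flip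
    have e0 : ∀ y, realKernel W 0 (φ 1 y) = realKernel W 1 y := fun y => by
      rw [realKernel, ← hφ]; rfl
    have e1 : ∀ y, realKernel W 1 (φ 1 y) = realKernel W 0 y := fun y => by
      rw [realKernel, ← hφ]; rfl
    simp only [hD]
    rw [← Equiv.tsum_eq (φ 1)
      fun y => realKernel W 0 y * Real.logb 2 (realKernel W 0 y / meanKernel W y)]
    refine tsum_congr fun y => ?_
    simp only [meanKernel, e0, e1, add_comm]
  have h2 := (((summable_divergence W 0).hasSum.add (summable_divergence W 1).hasSum).div_const 2)
  have h3 : info (realKernel W) = (D 0 + D 1) / 2 := by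
    refine HasSum.unique (isKernel_realKernel W).hasSum_info ?_
    simpa only [infoTerm_realKernel] using h2
  have h4 : info (realKernel W) = D x := by
    rw [h3, h1]
    rcases zmod_two_cases x with rfl | rfl
    · ring
    · rw [h1]; ring
  rw [h4]
  exact (summable_divergence W x).hasSum

theorem toReal_bind {Y : Type*} (p : PMF (ZMod 2)) (W : BinaryChannel Y) (y : Y) :
    (p.bind W y).toReal =
      (p 0).toReal * realKernel W 0 y + (p 1).toReal * realKernel W 1 y := by
  rw [PMF.bind_apply, tsum_fintype, sum_zmod_two, ENNReal.toReal_add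
    (ENNReal.mul_ne_top (PMF.apply_ne_top _ _) (PMF.apply_ne_top _ _))
    (ENNReal.mul_ne_top (PMF.apply_ne_top _ _) (PMF.apply_ne_top _ _)), ENNReal.toReal_mul,
    ENNReal.toReal_mul]
  rfl

/-- With `q` the output law under `p` and `m` the one under a uniform input, `I(X;Y)` is the
`p`-average of the divergences of the rows from `m`, minus the divergence of `q` from `m`. The
average equals `info W` by symmetry, and the subtracted term is nonnegative by Gibbs. -/
theorem IsSymmetric.mutualInfo_le {Y : Type*} {W : BinaryChannel Y} (hW : IsSymmetric W)
    (p : PMF (ZMod 2)) : mutualInfo p W ≤ info (realKernel W) := by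
  have hl : 0 < Real.log 2 := Real.log_pos (by norm_num)
  unfold mutualInfo
  by_cases hs : Summable fun y => ∑ x, (p x * W x y).toReal *
      Real.logb 2 ((W x y).toReal / (p.bind W y).toReal)
  swap
  -- A divergent sum has the default value 0, which lies below `info W`.
  · rw [tsum_eq_zero_of_not_summable hs]
    exact tsum_nonneg fun y => infoTerm_nonneg (realKernel_nonneg _ _ _) (realKernel_nonneg _ _ _)
  have hp : (p 0).toReal + (p 1).toReal = 1 := by
    have := (hasSum_toReal_pmf p).unique (hasSum_fintype _)
    rw [sum_zmod_two] at this
    exact this.symm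
  have hk := isKernel_realKernel W
  have hsum := (((hW.hasSum_divergence 0).mul_left (p 0).toReal).add
    ((hW.hasSum_divergence 1).mul_left (p 1).toReal)).sub
    (((((hk.hasSum 0).mul_left (p 0).toReal).add ((hk.hasSum 1).mul_left (p 1).toReal)).sub
      (hasSum_meanKernel W)).div_const (Real.log 2))
  have htot : (p 0).toReal * info (realKernel W) + (p 1).toReal * info (realKernel W) -
      ((p 0).toReal * 1 + (p 1).toReal * 1 - 1) / Real.log 2 = info (realKernel W) := by
    rw [← add_mul, mul_one, mul_one, hp]; simp
  rw [htot] at hsum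
  refine hasSum_le (fun y => ?_) hs.hasSum hsum
  have h0 := realKernel_nonneg W 0 y
  have h1 := realKernel_nonneg W 1 y
  have p0 : 0 ≤ (p 0).toReal := ENNReal.toReal_nonneg
  have p1 : 0 ≤ (p 1).toReal := ENNReal.toReal_nonneg
  rw [sum_zmod_two, toReal_bind, ENNReal.toReal_mul, ENNReal.toReal_mul]
  change (p 0).toReal * realKernel W 0 y * Real.logb 2 (realKernel W 0 y / _) +
    (p 1).toReal * realKernel W 1 y * Real.logb 2 (realKernel W 1 y / _) ≤ _
  set q := (p 0).toReal * realKernel W 0 y + (p 1).toReal * realKernel W 1 y with hq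
  set m := meanKernel W y with hm
  have hq0 : 0 ≤ q := by positivity
  have hmr : ∀ x, realKernel W x y ≠ 0 → m ≠ 0 := fun x hx hm0 => hx (realKernel_eq_zero hm0 x)
  have hg := sub_div_log_two_le hq0 (meanKernel_nonneg W y) fun h => by
    rw [hq, realKernel_eq_zero h, realKernel_eq_zero h]; simp
  rw [mul_logb_div_eq_sub (m := m) (fun h => ⟨?_, hmr 0 (right_ne_zero_of_mul h)⟩) _ _ rfl,
    mul_logb_div_eq_sub (m := m) (fun h => ⟨?_, hmr 1 (right_ne_zero_of_mul h)⟩) _ _ rfl]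
  · nlinarith
  · have : 0 < (p 1).toReal * realKernel W 1 y := lt_of_le_of_ne (by positivity) (Ne.symm h)
    positivity
  · have : 0 < (p 0).toReal * realKernel W 0 y := lt_of_le_of_ne (by positivity) (Ne.symm h)
    positivity

theorem mutualInfo_uniform {Y : Type*} (W : BinaryChannel Y) :
    mutualInfo (PMF.uniformOfFintype (ZMod 2)) W = info (realKernel W) := by
  refine tsum_congr fun y => ?_
  have h : ∀ x : ZMod 2, (PMF.uniformOfFintype (ZMod 2) x).toReal = 1 / 2 := fun x => by
    simp [PMF.uniformOfFintype_apply, ZMod.card]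
  rw [sum_zmod_two, toReal_bind, ENNReal.toReal_mul, ENNReal.toReal_mul, h, h,
    infoTerm_realKernel, meanKernel,
    show 1 / 2 * realKernel W 0 y + 1 / 2 * realKernel W 1 y =
      (realKernel W 0 y + realKernel W 1 y) / 2 by ring]
  change 1 / 2 * realKernel W 0 y * Real.logb 2 (realKernel W 0 y / _) +
    1 / 2 * realKernel W 1 y * Real.logb 2 (realKernel W 1 y / _) = _
  ring

/-- The capacity of a symmetric channel is its mutual information under a uniform input. -/
theorem IsSymmetric.capacity_eq {Y : Type*} {W : BinaryChannel Y} (hW : IsSymmetric W) :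
    capacity W = info (realKernel W) := by
  refine le_antisymm (ciSup_le hW.mutualInfo_le) ?_
  rw [← mutualInfo_uniform]
  exact le_ciSup (f := fun p => mutualInfo p W)
    ⟨_, Set.forall_mem_range.2 hW.mutualInfo_le⟩ (PMF.uniformOfFintype (ZMod 2))

/-! ### A lower bound on conditional entropy -/

/-- The weights that put one half on the only value whose error event does not occur and share
one half among the other values form a subprobability. -/
theorem sum_guess_le_one {T : Type*} [Fintype T] (E : T → Prop) [DecidablePred E]
    (hE : ∀ t t', ¬ E t → ¬ E t' → t = t') :
    ∑ t, (if E t then 1 / (2 * Fintype.card T : ℝ) else 1 / 2) ≤ 1 := by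
  have h1 : ∀ t, (if E t then 1 / (2 * Fintype.card T : ℝ) else 1 / 2) ≤
      1 / (2 * Fintype.card T : ℝ) + if E t then 0 else 1 / 2 := by
    intro t
    split_ifs
    · simp
    · have : (0 : ℝ) ≤ 1 / (2 * Fintype.card T : ℝ) := by positivity
      linarith
  refine (Finset.sum_le_sum fun t _ => h1 t).trans ?_
  rw [Finset.sum_add_distrib]
  have h2 : ∑ _t : T, 1 / (2 * Fintype.card T : ℝ) ≤ 1 / 2 := by
    rw [Finset.sum_const, Finset.card_univ, nsmul_eq_mul]
    by_cases h : (Fintype.card T : ℝ) = 0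
    · simp [h]
    · apply le_of_eq; field_simp
  have h3 : ∑ t : T, (if E t then (0 : ℝ) else 1 / 2) ≤ 1 / 2 := by
    by_cases h : ∃ t, ¬ E t
    · obtain ⟨t, ht⟩ := h
      rw [Finset.sum_eq_single t]
      · simp [ht]
      · intro t' _ hne
        rw [if_pos]
        by_contra h'
        exact hne (hE _ _ h' ht)
      · simp
    · push Not at h
      simp [h]
  linarith

/-- One term of the entropy decomposition: `c k` is the joint probability of `(s, t, z)`, `Q` that
of `(s, z)`, `R` that of `z`, and `g` is a guessed conditional probability of `t`. The logarithm of
`Q / R` is expanded through `m`, and Gibbs against `Q g` replaces the true conditional probability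
`c k / Q` by `g`. -/
theorem neg_mul_logb_ge {c k Q R m g : ℝ} (hc : 0 < c) (hk : 0 ≤ k) (hm : 0 ≤ m) (hg : 0 < g)
    (hkQ : c * k ≤ Q) (hQR : Q ≤ R) (hkm : m = 0 → k = 0) :
    (c * k) * (-Real.logb 2 c) - c * (k * Real.logb 2 (k / m)) + (c * k) * Real.logb 2 (R / m)
      + (c * k) * Real.logb 2 g + (c * k - Q * g) / Real.log 2 ≤
      -(c * k * Real.logb 2 (Q / R)) := by
  have hl : 0 < Real.log 2 := Real.log_pos (by norm_num)
  have hQ : 0 ≤ Q := le_trans (by positivity) hkQ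
  rcases hk.eq_or_lt with rfl | hk
  · simp only [mul_zero, zero_mul, zero_div, Real.logb_zero, zero_sub, add_zero, neg_zero]
    rw [neg_div]
    simp only [zero_add, Left.neg_nonpos_iff]
    positivity
  have hm : 0 < m := lt_of_le_of_ne hm fun h => hk.ne' (hkm h.symm)
  have hck : 0 < c * k := mul_pos hc hk
  have hQ : 0 < Q := hck.trans_le hkQ
  have hR : 0 < R := hQ.trans_le hQR
  have := sub_div_log_two_le hck.le (mul_pos hQ hg).le (fun h => absurd h (mul_pos hQ hg).ne')
  rw [Real.logb_div hck.ne' (mul_pos hQ hg).ne', Real.logb_mul hc.ne' hk.ne',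
    Real.logb_mul hQ.ne' hg.ne'] at this
  rw [Real.logb_div hk.ne' hm.ne', Real.logb_div hR.ne' hm.ne', Real.logb_div hQ.ne' hR.ne']
  nlinarith

/-- Let `(s, t)` be uniform and let `K s t` be the law of the output `z`. If the divergence of
`K s t` from `m` is `D`, and `t` can be recovered from `s` and `z` outside an error event of
probability at most `δ`, then `s` has conditional entropy at least
`log (|S| |T|) - D - 1 - δ log |T|`. -/
theorem condEntropy_sum_ge {S T O : Type*} [Fintype S] [Fintype T] [Nonempty S] [Nonempty T]
    (K : S → T → O → ℝ) (m : O → ℝ) (E : S → T → Set O) (D δ : ℝ)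
    (hK0 : ∀ s t z, 0 ≤ K s t z) (hK : ∀ s t, HasSum (K s t) 1)
    (hm0 : ∀ z, 0 ≤ m z) (hm : HasSum m 1) (hKm : ∀ s t z, m z = 0 → K s t z = 0)
    (hD : ∀ s t, HasSum (fun z => K s t z * Real.logb 2 (K s t z / m z)) D)
    (hE : ∀ s t t' z, z ∉ E s t → z ∉ E s t' → t = t')
    (hδ : ∀ s t, ∑' z, (E s t).indicator (K s t) z ≤ δ)
    (c : ℝ) (hc : c = (Fintype.card S * Fintype.card T : ℝ)⁻¹) :
    -Real.logb 2 c - D - 1 - Real.logb 2 (Fintype.card T) * δ ≤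
      ∑' z, ∑ s, -((c * ∑ t, K s t z) *
        Real.logb 2 ((c * ∑ t, K s t z) / (c * ∑ s, ∑ t, K s t z))) := by
  classical
  have hl : 0 < Real.log 2 := Real.log_pos (by norm_num)
  have hS : 0 < (Fintype.card S : ℝ) := by exact_mod_cast Fintype.card_pos
  have hT : 0 < (Fintype.card T : ℝ) := by exact_mod_cast Fintype.card_pos
  have hT1 : (1 : ℝ) ≤ Fintype.card T := by exact_mod_cast Fintype.card_pos
  have hc0 : 0 < c := by rw [hc]; positivity
  have hlogT : 0 ≤ Real.logb 2 (Fintype.card T) := Real.logb_nonneg (by norm_num) hT1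
  set Q : S → O → ℝ := fun s z => c * ∑ t, K s t z with hQdef
  set R : O → ℝ := fun z => c * ∑ s, ∑ t, K s t z with hRdef
  have hKQ : ∀ s t z, c * K s t z ≤ Q s z := fun s t z =>
    mul_le_mul_of_nonneg_left (Finset.single_le_sum (f := fun t => K s t z)
      (fun t _ => hK0 s t z) (Finset.mem_univ t)) hc0.le
  have hQ0 : ∀ s z, 0 ≤ Q s z := fun s z =>
    mul_nonneg hc0.le (Finset.sum_nonneg fun t _ => hK0 s t z)
  have hQR : ∀ s z, Q s z ≤ R z := fun s z =>
    mul_le_mul_of_nonneg_left (Finset.single_le_sum (f := fun s => ∑ t, K s t z)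
      (fun s _ => Finset.sum_nonneg fun t _ => hK0 s t z) (Finset.mem_univ s)) hc0.le
  have hR0 : ∀ z, 0 ≤ R z := fun z => mul_nonneg hc0.le
    (Finset.sum_nonneg fun s _ => Finset.sum_nonneg fun t _ => hK0 s t z)
  have havg : ∀ x : ℝ, c * ∑ _s : S, ∑ _t : T, x = x := fun x => by
    simp only [Finset.sum_const, Finset.card_univ, nsmul_eq_mul, hc]
    field_simp
  have hRsum : HasSum R 1 := by
    have := (hasSum_sum (s := (Finset.univ : Finset S)) fun s _ =>
      hasSum_sum (s := (Finset.univ : Finset T)) fun t _ => hK s t).mul_left c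
    rwa [havg] at this
  have hQsum : ∀ s, Summable (Q s) := fun s =>
    Summable.of_nonneg_of_le (hQ0 s) (hQR s) hRsum.summable
  have hlhs : Summable fun z => ∑ s, -(Q s z * Real.logb 2 (Q s z / R z)) := by
    refine summable_sum fun s _ => ?_
    refine Summable.of_nonneg_of_le (fun z => ?_) (fun z => ?_)
      ((hRsum.summable.sub (hQsum s)).div_const (Real.log 2))
    · have : Real.logb 2 (Q s z / R z) ≤ 0 := by
        apply Real.logb_nonpos (by norm_num) (div_nonneg (hQ0 s z) (hR0 z))
        exact div_le_one_of_le₀ (hQR s z) (hR0 z)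
      nlinarith [hQ0 s z]
    · have := sub_div_log_two_le (hQ0 s z) (hR0 z) fun h => le_antisymm (h ▸ hQR s z) (hQ0 s z)
      rw [sub_div] at this ⊢
      linarith
  have herr := (hasSum_sum (s := (Finset.univ : Finset S)) fun s _ =>
    hasSum_sum (s := (Finset.univ : Finset T)) fun t _ =>
      ((hK s t).summable.indicator (E s t)).hasSum).mul_left c
  have hdiv := (hasSum_sum (s := (Finset.univ : Finset S)) fun s _ =>
    hasSum_sum (s := (Finset.univ : Finset T)) fun t _ => hD s t).mul_left c
  rw [havg] at hdiv
  -- The summed lower bound: `-log c` is the entropy of `(s, t)`, then the divergence `D` is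
  -- subtracted; the middle term sums to 0, and the last is the Fano loss of one bit plus `log |T|`
  -- on the error event.
  have hrhs := (((hRsum.mul_right (-Real.logb 2 c)).sub hdiv).add
    ((hRsum.sub hm).div_const (Real.log 2))).sub
    (hRsum.add (herr.mul_left (Real.logb 2 (Fintype.card T))))
  have hδ' : c * ∑ s, ∑ t, ∑' z, (E s t).indicator (K s t) z ≤ δ := by
    rw [← havg δ]
    exact mul_le_mul_of_nonneg_left (Finset.sum_le_sum fun s _ => Finset.sum_le_sum fun t _ =>
      hδ s t) hc0.le
  refine le_trans ?_ (hasSum_le (fun z => ?_) hrhs hlhs.hasSum)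
  · have := mul_le_mul_of_nonneg_left hδ' hlogT
    simp only [sub_self, zero_div]
    linarith
  -- The guess costs one bit when no error occurs and `1 + log |T|` bits otherwise, which is Fano's
  -- inequality without a decoder.
  set g : S → T → ℝ := fun s t => if z ∈ E s t then 1 / (2 * Fintype.card T : ℝ) else 1 / 2
    with hgdef
  have hg0 : ∀ s t, 0 < g s t := fun s t => by
    simp only [hgdef]; split_ifs <;> positivity
  have hlogg : ∀ s t, c * K s t z * Real.logb 2 (g s t) =
      -(c * K s t z) - Real.logb 2 (Fintype.card T) * (c * (E s t).indicator (K s t) z) := by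
    intro s t
    simp only [hgdef, Set.indicator_apply]
    split_ifs
    · rw [one_div, Real.logb_inv, Real.logb_mul (by norm_num) hT.ne', Real.logb_self_eq_one
        (by norm_num)]
      ring
    · rw [one_div, Real.logb_inv, Real.logb_self_eq_one (by norm_num)]
      ring
  have hgQ : ∀ s, Q s z * ∑ t, g s t ≤ Q s z := fun s =>
    mul_le_of_le_one_right (hQ0 s z) (sum_guess_le_one (fun t => z ∈ E s t)
      fun t t' h h' => hE s t t' z h h')
  have hQsplit : ∀ s, -(Q s z * Real.logb 2 (Q s z / R z)) =
      ∑ t, -(c * K s t z * Real.logb 2 (Q s z / R z)) := fun s => by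
    rw [Finset.sum_neg_distrib, ← Finset.sum_mul, ← Finset.mul_sum]
  have hmain := Finset.sum_le_sum fun s (_ : s ∈ Finset.univ) =>
    Finset.sum_le_sum fun t (_ : t ∈ Finset.univ) =>
      neg_mul_logb_ge hc0 (hK0 s t z) (hm0 z) (hg0 s t) (hKQ s t z) (hQR s z) (hKm s t z)
  simp only [hQsplit]
  refine le_trans ?_ hmain
  simp only [hlogg, Finset.sum_add_distrib, Finset.sum_sub_distrib, Finset.sum_neg_distrib,
    ← Finset.sum_mul, ← Finset.mul_sum, ← Finset.sum_div]
  -- Gibbs for the output law against `m`: this is where `D` is seen to bound the mutual information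
  -- of `(s, t)` and `z` from above.
  have hRm := sub_div_log_two_le (hR0 z) (hm0 z) fun h => by
    simp [hRdef, hKm _ _ z h]
  have hQg : 0 ≤ (c * ∑ s, ∑ t, K s t z - ∑ s, Q s z * ∑ t, g s t) / Real.log 2 := by
    apply div_nonneg _ hl.le
    rw [sub_nonneg, Finset.mul_sum]
    exact Finset.sum_le_sum fun s _ => hgQ s
  change R z * -Real.logb 2 c - _ + (R z - m z) / Real.log 2 - (R z + _) ≤
    R z * -Real.logb 2 c - _ + R z * Real.logb 2 (R z / m z) + (-R z - _) + _
  linarith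

/-! ### Divergence of the block channel from the product of the mean output laws -/

theorem hasSum_pi_prod {Y : Type*} {N : ℕ} {f : Fin N → Y → ℝ} {s : Fin N → ℝ}
    (h : ∀ j, HasSum (f j) (s j)) : HasSum (fun y : Fin N → Y => ∏ j, f j (y j)) (∏ j, s j) := by
  induction N with
  | zero => simp
  | succ N ih =>
    rw [← (Fin.consEquiv fun _ : Fin (N + 1) => Y).hasSum_iff, Fin.prod_univ_succ]
    have h0 := hasSum_mul_prod (h 0) (ih fun j => h j.succ)
    convert h0 using 1
    funext ⟨a, y⟩
    simp [Fin.consEquiv, Fin.prod_univ_succ]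

theorem hasSum_prod_meanKernel {Y : Type*} (V : BinaryChannel Y) (N : ℕ) :
    HasSum (fun y : Fin N → Y => ∏ j, meanKernel V (y j)) 1 := by
  simpa using hasSum_pi_prod fun _ : Fin N => hasSum_meanKernel V

/-- Divergence is additive over product laws: the logarithm of the product is a sum, and in its
`j`-th part every factor but the `j`-th sums to 1. By symmetry each part equals `info V`, whatever
the codeword. -/
theorem IsSymmetric.hasSum_vectorKernel_divergence {Y : Type*} {V : BinaryChannel Y}
    (hV : IsSymmetric V) {n : ℕ} (u : Fin (2 ^ n) → ZMod 2) :
    HasSum (fun y => vectorKernel V u y *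
      Real.logb 2 (vectorKernel V u y / ∏ j, meanKernel V (y j)))
      (2 ^ n * info (realKernel V)) := by
  set x := Matrix.vecMul u (generator n) with hx
  have h1 : ∀ j : Fin (2 ^ n), HasSum (fun y : Fin (2 ^ n) → Y => ∏ k,
      if k = j then realKernel V (x k) (y k) *
        Real.logb 2 (realKernel V (x k) (y k) / meanKernel V (y k))
      else realKernel V (x k) (y k)) (∏ k, if k = j then info (realKernel V) else 1) := by
    intro j
    refine hasSum_pi_prod (f := fun k y => if k = j then realKernel V (x k) y *
        Real.logb 2 (realKernel V (x k) y / meanKernel V y) else realKernel V (x k) y) fun k => ?_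
    split_ifs
    · exact hV.hasSum_divergence (x k)
    · exact (isKernel_realKernel V).hasSum (x k)
  have h2 := hasSum_sum (s := Finset.univ) fun j _ => h1 j
  have h3 : ∑ j : Fin (2 ^ n), ∏ k, (if k = j then info (realKernel V) else 1) =
      2 ^ n * info (realKernel V) := by simp
  rw [h3] at h2
  convert h2 using 1
  funext y
  have h4 : ∀ j, (∏ k, if k = j then realKernel V (x k) (y k) *
        Real.logb 2 (realKernel V (x k) (y k) / meanKernel V (y k))
      else realKernel V (x k) (y k)) = vectorKernel V u y *
        Real.logb 2 (realKernel V (x j) (y j) / meanKernel V (y j)) := by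
    intro j
    rw [show vectorKernel V u y = ∏ k, realKernel V (x k) (y k) from rfl]
    rw [← Finset.prod_ite_eq' Finset.univ j (fun k =>
      Real.logb 2 (realKernel V (x k) (y k) / meanKernel V (y k))) |>.trans
        (if_pos (Finset.mem_univ j)),
      ← Finset.prod_mul_distrib]
    refine Finset.prod_congr rfl fun k _ => ?_
    split_ifs <;> simp
  simp only [h4]
  rw [← Finset.mul_sum]
  by_cases h0 : vectorKernel V u y = 0
  · simp [h0]
  have hne : ∀ j, realKernel V (x j) (y j) ≠ 0 := fun j => (Finset.prod_ne_zero_iff.1 h0) j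
    (Finset.mem_univ j)
  have hme : ∀ j, meanKernel V (y j) ≠ 0 := fun j h => hne j (realKernel_eq_zero h _)
  congr 1
  rw [show vectorKernel V u y = ∏ k, realKernel V (x k) (y k) from rfl, ← Finset.prod_div_distrib]
  unfold Real.logb
  rw [Real.log_prod (fun j _ => div_ne_zero (hne j) (hme j)), Finset.sum_div]

/-! ### Equivocation of a nested polar code -/

theorem map_mk_apply {S O : Type*} [DecidableEq S] (p : PMF O) (a s : S) (z : O) :
    (p.map fun y => (a, y)) (s, z) = if s = a then p z else 0 := by
  classical
  rw [PMF.map_apply]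
  by_cases h : s = a
  · subst h
    rw [if_pos rfl, tsum_eq_single z]
    · simp
    · intro y hy
      rw [if_neg]
      simpa using Ne.symm hy
  · simp [h]

namespace NestedPolarCode

variable {n : ℕ} (P : NestedPolarCode n)

theorem map_law {Y : Type*} (V : BinaryChannel Y) :
    (P.law V).map (fun ω => (ω.1.1, ω.2)) =
      (PMF.uniformOfFintype (P.Message × P.Randomness)).bind fun st =>
        (vectorChannel V (P.inputBits st.1 st.2)).map fun y => (st.1, y) := by
  rw [law, PMF.map_bind]
  congr 1
  funext st
  rw [PMF.map_comp]
  rfl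

theorem toReal_map_law_apply {Y : Type*} (V : BinaryChannel Y) (s : P.Message)
    (z : Fin (2 ^ n) → Y) :
    ((P.law V).map (fun ω => (ω.1.1, ω.2)) (s, z)).toReal =
      (Fintype.card P.Message * Fintype.card P.Randomness : ℝ)⁻¹ *
        ∑ t, vectorKernel V (P.inputBits s t) z := by
  classical
  rw [map_law, PMF.bind_apply, tsum_fintype, ENNReal.toReal_sum fun st _ =>
    ENNReal.mul_ne_top (PMF.apply_ne_top _ _) (PMF.apply_ne_top _ _)]
  rw [Fintype.sum_prod_type, Finset.sum_eq_single s]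
  · rw [Finset.mul_sum]
    refine Finset.sum_congr rfl fun t _ => ?_
    rw [map_mk_apply, if_pos rfl, ENNReal.toReal_mul, toReal_vectorChannel,
      PMF.uniformOfFintype_apply, Fintype.card_prod]
    simp
  · intro s' _ hne
    refine Finset.sum_eq_zero fun t _ => ?_
    rw [map_mk_apply, if_neg (Ne.symm hne)]
    simp
  · simp

theorem toReal_map_snd_map_law_apply {Y : Type*} (V : BinaryChannel Y) (z : Fin (2 ^ n) → Y) :
    (((P.law V).map (fun ω => (ω.1.1, ω.2))).map Prod.snd z).toReal =
      (Fintype.card P.Message * Fintype.card P.Randomness : ℝ)⁻¹ *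
        ∑ s, ∑ t, vectorKernel V (P.inputBits s t) z := by
  have : ((P.law V).map (fun ω => (ω.1.1, ω.2))).map Prod.snd =
      (PMF.uniformOfFintype (P.Message × P.Randomness)).bind fun st =>
        vectorChannel V (P.inputBits st.1 st.2) := by
    rw [map_law, PMF.map_bind]
    congr 1
    funext st
    rw [PMF.map_comp]
    exact PMF.map_id _
  rw [this, PMF.bind_apply, tsum_fintype, ENNReal.toReal_sum fun st _ =>
    ENNReal.mul_ne_top (PMF.apply_ne_top _ _) (PMF.apply_ne_top _ _), Fintype.sum_prod_type,
    Finset.mul_sum]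
  refine Finset.sum_congr rfl fun s _ => ?_
  rw [Finset.mul_sum]
  refine Finset.sum_congr rfl fun t _ => ?_
  rw [ENNReal.toReal_mul, toReal_vectorChannel, PMF.uniformOfFintype_apply, Fintype.card_prod]
  simp

/-- Given the message, at most one value of the randomness has no error event. -/
theorem randomness_unique {Y : Type*} (V : BinaryChannel Y) (s : P.Message) (t t' : P.Randomness)
    (z : Fin (2 ^ n) → Y) (h : ∀ i ∈ P.B, z ∉ ErrorEvent V i (P.inputBits s t))
    (h' : ∀ i ∈ P.B, z ∉ ErrorEvent V i (P.inputBits s t')) : t = t' := by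
  have key : ∀ (k : ℕ) (i : Fin (2 ^ n)), i.val = k → P.inputBits s t i = P.inputBits s t' i := by
    intro k
    induction k using Nat.strong_induction_on with
    | _ k ih =>
      intro i hi
      by_cases hB : i ∈ P.B
      · have hpast : (fun j : {j // j < i} => P.inputBits s t j.1) =
            fun j => P.inputBits s t' j.1 := funext fun j => ih j.1.val (hi ▸ j.2) j.1 rfl
        have e := h i hB
        have e' := h' i hB
        simp only [ErrorEvent, Set.mem_ofPred_eq, not_le] at e e'
        rw [hpast] at e
        have h11 : (1 + 1 : ZMod 2) = 0 := rfl
        rcases zmod_two_cases (P.inputBits s t i) with h1 | h1 <;>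
          rcases zmod_two_cases (P.inputBits s t' i) with h2 | h2 <;>
          rw [h1] at e ⊢ <;> rw [h2] at e' ⊢ <;> simp only [zero_add, h11] at e e'
        · exact absurd e (not_lt.2 e'.le)
        · exact absurd e (not_lt.2 e'.le)
      · simp only [inputBits, hB, dif_neg, not_false_iff]
  funext i
  rw [← P.inputBits_randomness s t i, ← P.inputBits_randomness s t' i]
  exact key _ _ rfl

theorem card_message : (Fintype.card P.Message : ℝ) = 2 ^ (P.A \ P.B).card := by
  simp only [Message, Fintype.card_fun, ZMod.card, Fintype.card_coe, Nat.cast_pow, Nat.cast_ofNat]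

theorem card_randomness : (Fintype.card P.Randomness : ℝ) = 2 ^ P.B.card := by
  simp only [Randomness, Fintype.card_fun, ZMod.card, Fintype.card_coe, Nat.cast_pow,
    Nat.cast_ofNat]

theorem rate_eq : P.rate = ((P.A.card : ℝ) - P.B.card) / 2 ^ n := by
  rw [rate, card_message, Real.logb_pow, Real.logb_self_eq_one (by norm_num), mul_one,
    Finset.card_sdiff_of_subset P.subset, Nat.cast_sub (Finset.card_le_card P.subset)]

/-- `condEntropy_sum_ge` with the product of mean output laws as reference and, as error event, a
failure of some bit of `B`. Given the message, the bits outside `B` are known, so only those of `B`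
have to be resolved. -/
theorem equivocation_ge {Z : Type*} {V : BinaryChannel Z} (hV : IsSymmetric V) :
    (P.A.card : ℝ) - 2 ^ n * info (realKernel V) - 1 -
      P.B.card * ∑ i ∈ P.B, bhatt (bitKernel V i) ≤ P.equivocation V := by
  unfold equivocation condEntropy
  simp only [toReal_map_law_apply, toReal_map_snd_map_law_apply]
  have h := condEntropy_sum_ge (fun s t => vectorKernel V (P.inputBits s t))
    (fun z => ∏ j, meanKernel V (z j))
    (fun s t => ⋃ i ∈ P.B, ErrorEvent V i (P.inputBits s t))
    (2 ^ n * info (realKernel V)) (∑ i ∈ P.B, bhatt (bitKernel V i))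
    (fun s t => vectorKernel_nonneg V _) (fun s t => hasSum_vectorKernel V _)
    (fun z => Finset.prod_nonneg fun j _ => meanKernel_nonneg V _) (hasSum_prod_meanKernel V _)
    (fun s t z hz => by
      obtain ⟨j, -, hj⟩ := Finset.prod_eq_zero_iff.1 hz
      exact Finset.prod_eq_zero (Finset.mem_univ j) (realKernel_eq_zero hj _))
    (fun s t => hV.hasSum_vectorKernel_divergence _)
    (fun s t t' z hz hz' => P.randomness_unique V s t t' z
      (fun i hi h => hz (Set.mem_biUnion hi h)) (fun i hi h => hz' (Set.mem_biUnion hi h)))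
    (fun s t => by
      classical
      set u := P.inputBits s t
      calc _ ≤ ∑' z, ∑ i ∈ P.B, (ErrorEvent V i u).indicator (vectorKernel V u) z := by
            refine Summable.tsum_le_tsum (fun z => ?_) (summable_indicator_vectorKernel V u _)
              (summable_sum fun i _ => summable_indicator_vectorKernel V u _)
            have hnn : ∀ i ∈ P.B, 0 ≤ (ErrorEvent V i u).indicator (vectorKernel V u) z :=
              fun i _ => Set.indicator_nonneg (fun z _ => vectorKernel_nonneg V u z) z
            by_cases hz : z ∈ ⋃ i ∈ P.B, ErrorEvent V i u
            · rw [Set.indicator_of_mem hz]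
              simp only [Set.mem_iUnion] at hz
              obtain ⟨i, hi, hz⟩ := hz
              refine le_trans (le_of_eq ?_) (Finset.single_le_sum hnn hi)
              rw [Set.indicator_of_mem hz]
            · rw [Set.indicator_of_notMem hz]
              exact Finset.sum_nonneg hnn
        _ = ∑ i ∈ P.B, ∑' z, (ErrorEvent V i u).indicator (vectorKernel V u) z :=
            Summable.tsum_finsetSum fun i _ => summable_indicator_vectorKernel V u _
        _ ≤ _ := Finset.sum_le_sum fun i _ => hV.tsum_errorEvent_le i u) _ rfl
  have hlog : -Real.logb 2 (Fintype.card P.Message * Fintype.card P.Randomness : ℝ)⁻¹ =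
      P.A.card := by
    rw [Real.logb_inv, neg_neg, card_message, card_randomness, ← pow_add, Real.logb_pow,
      Real.logb_self_eq_one (by norm_num), mul_one, Finset.card_sdiff_of_subset P.subset,
      Nat.sub_add_cancel (Finset.card_le_card P.subset)]
  have hlogT : Real.logb 2 (Fintype.card P.Randomness : ℝ) = P.B.card := by
    rw [card_randomness, Real.logb_pow, Real.logb_self_eq_one (by norm_num), mul_one]
  rw [hlog, hlogT] at h
  exact h

end NestedPolarCode

/-! ### Degraded channels -/

theorem IsDegraded.exists_realKernel {Y Z : Type*} {V : BinaryChannel Z} {W : BinaryChannel Y}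
    (h : IsDegraded V W) : ∃ q : Y → Z → ℝ, (∀ y z, 0 ≤ q y z) ∧ (∀ y, HasSum (q y) 1) ∧
      ∀ x z, HasSum (fun y => q y z * realKernel W x y) (realKernel V x z) := by
  obtain ⟨Q, hQ⟩ := h
  refine ⟨fun y z => (Q y z).toReal, fun _ _ => ENNReal.toReal_nonneg,
    fun y => hasSum_toReal_pmf (Q y), fun x z => ?_⟩
  have hfin : ∑' y, Q y z * W x y ≠ ⊤ := by rw [← hQ]; exact PMF.apply_ne_top _ _
  have := ENNReal.hasSum_toReal hfin
  rw [← ENNReal.tsum_toReal_eq (fun y =>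
    ENNReal.mul_ne_top (PMF.apply_ne_top _ _) (PMF.apply_ne_top _ _)), ← hQ] at this
  simp only [ENNReal.toReal_mul] at this
  exact this

/-- The Bhattacharyya parameter does not decrease when the output is processed further. -/
theorem bhatt_le_of_degraded {O O' : Type*} {f : ZMod 2 → O → ℝ} {g : ZMod 2 → O' → ℝ}
    (hf : IsKernel f) (hg : IsKernel g) (q : O → O' → ℝ) (hq0 : ∀ o o', 0 ≤ q o o')
    (hq : ∀ o, HasSum (q o) 1)
    (hfg : ∀ b o', HasSum (fun o => q o o' * f b o) (g b o')) : bhatt f ≤ bhatt g := by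
  have hpos : ∀ o' o, 0 ≤ q o o' * √(f 0 o * f 1 o) := fun o' o =>
    mul_nonneg (hq0 o o') (Real.sqrt_nonneg _)
  have hq' : ∀ o, HasSum (fun o' => q o o' * √(f 0 o * f 1 o)) √(f 0 o * f 1 o) := fun o => by
    simpa using (hq o).mul_right √(f 0 o * f 1 o)
  have hsum : Summable fun p : O × O' => q p.1 p.2 * √(f 0 p.1 * f 1 p.1) := by
    rw [summable_prod_of_nonneg fun p => hpos p.2 p.1]
    refine ⟨fun o => (hq' o).summable, ?_⟩
    simp only [(hq' _).tsum_eq]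
    exact hf.hasSum_bhatt.summable
  have hsum' := hsum.prod_symm
  have h1 : bhatt f = ∑' o', ∑' o, q o o' * √(f 0 o * f 1 o) := by
    have e1 := hsum.tsum_prod
    have e2 := hsum'.tsum_prod
    simp only [(hq' _).tsum_eq, Prod.fst_swap, Prod.snd_swap] at e1 e2
    rw [bhatt, ← e1, ← e2]
    exact ((Equiv.prodComm O' O).tsum_eq _).symm
  rw [h1]
  refine Summable.tsum_le_tsum (fun o' => ?_) hsum'.prod hg.hasSum_bhatt.summable
  refine Real.le_sqrt_of_sq_le ?_
  have hT := (hsum'.prod_factor o').hasSum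
  simp only [Prod.fst_swap, Prod.snd_swap] at hT
  -- Cauchy–Schwarz by discriminant: the quadratic is the `q`-weighted sum of `(√(f 0 o) x - √(f 1
  -- o)) ^ 2`.
  have hquad : ∀ x : ℝ, 0 ≤ g 0 o' * (x * x) +
      -(2 * ∑' o, q o o' * √(f 0 o * f 1 o)) * x + g 1 o' := by
    intro x
    have := (((hfg 0 o').mul_right (x * x)).add ((hT.mul_left 2).neg.mul_right x)).add (hfg 1 o')
    refine this.nonneg fun o => ?_
    have e0 := Real.sq_sqrt (hf.nonneg 0 o)
    have e1 := Real.sq_sqrt (hf.nonneg 1 o)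
    rw [Real.sqrt_mul (hf.nonneg 0 o)]
    have := mul_nonneg (hq0 o o') (sq_nonneg (√(f 0 o) * x - √(f 1 o)))
    calc (0 : ℝ) ≤ _ := this
      _ = q o o' * √(f 0 o) ^ 2 * (x * x) + -(2 * (q o o' * (√(f 0 o) * √(f 1 o)))) * x +
          q o o' * √(f 1 o) ^ 2 := by ring
      _ = _ := by rw [e0, e1]
  have := discrim_le_zero hquad
  rw [discrim] at this
  linarith

/-- Degradation passes to the bit channels: each output letter is processed independently by `q`,
and the past bits are copied unchanged. -/
theorem IsDegraded.bhatt_bitKernel_le {Y Z : Type*} {V : BinaryChannel Z} {W : BinaryChannel Y}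
    (h : IsDegraded V W) {n : ℕ} (i : Fin (2 ^ n)) :
    bhatt (bitKernel W i) ≤ bhatt (bitKernel V i) := by
  obtain ⟨q, hq0, hq, hqW⟩ := h.exists_realKernel
  refine bhatt_le_of_degraded (isKernel_bitKernel W i) (isKernel_bitKernel V i)
    (fun (o : BitOutput Y i) (o' : BitOutput Z i) =>
      if o'.2 = o.2 then ∏ j, q (o.1 j) (o'.1 j) else 0) (fun o o' => ?_)
    (fun o => ?_) (fun b o' => ?_)
  · split_ifs
    · exact Finset.prod_nonneg fun j _ => hq0 _ _
    · exact le_rfl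
  · refine hasSum_ite_snd (g := fun o' : BitOutput Z i => ∏ j, q (o.1 j) (o'.1 j)) o.2 ?_
    simpa using hasSum_pi_prod fun j => hq (o.1 j)
  · have hv : ∀ v : Fin (2 ^ n) → ZMod 2, HasSum
        (fun y => (∏ j, q (y j) (o'.1 j)) * vectorKernel W v y) (vectorKernel V v o'.1) := by
      intro v
      have := hasSum_pi_prod fun j =>
        hqW (Matrix.vecMul v (generator n) j) (o'.1 j)
      simp only [Finset.prod_mul_distrib] at this
      exact this
    have hb : HasSum (fun y => (∏ j, q (y j) (o'.1 j)) * bitKernel W i b (y, o'.2))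
        (bitKernel V i b o') := by
      have := (hasSum_sum (s := Finset.univ) fun (v : Fin (2 ^ n) → ZMod 2) _ =>
        (show HasSum (fun y => if (∀ j, v j.1 = o'.2 j) ∧ v i = b then
            (∏ j, q (y j) (o'.1 j)) * vectorKernel W v y else 0)
          (if (∀ j, v j.1 = o'.2 j) ∧ v i = b then vectorKernel V v o'.1 else 0) by
          split_ifs
          · exact hv v
          · exact hasSum_zero)).mul_left (2 ^ (2 ^ n - 1))⁻¹
      refine (congrArg (fun F => HasSum F (bitKernel V i b o')) (funext fun y => ?_)).mpr this
      rw [bitKernel, mul_left_comm, Finset.mul_sum]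
      congr 1
      refine Finset.sum_congr rfl fun v _ => ?_
      rw [mul_ite, mul_zero]
    have := hasSum_ite_snd (g := fun o : BitOutput Y i =>
      (∏ j, q (o.1 j) (o'.1 j)) * bitKernel W i b o) o'.2 hb
    refine (congrArg (fun F => HasSum F (bitKernel V i b o')) (funext fun o => ?_)).mpr this
    simp only [ite_mul, zero_mul, eq_comm]

/-! ### The rate-equivocation region -/

/-- At most `N` parameters of size `N ^ (-2)` sum to at most `1 / N`, which leaves room for the
factor `|B| ≤ N` in the equivocation bound. -/
theorem sum_bhatt_le {Y : Type*} {n : ℕ} (W : BinaryChannel Y) (s : Finset (Fin (2 ^ n)))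
    (hs : ∀ i ∈ s, bhatt (bitKernel W i) ≤ ((4 : ℝ) ^ n)⁻¹) :
    ∑ i ∈ s, bhatt (bitKernel W i) ≤ ((2 : ℝ) ^ n)⁻¹ := by
  have hcard : (s.card : ℝ) ≤ 2 ^ n := by
    exact_mod_cast (Finset.card_le_univ s).trans_eq (Fintype.card_fin _)
  calc ∑ i ∈ s, bhatt (bitKernel W i) ≤ s.card * ((4 : ℝ) ^ n)⁻¹ := by
        simpa [nsmul_eq_mul] using Finset.sum_le_card_nsmul s _ _ hs
    _ ≤ 2 ^ n * ((4 : ℝ) ^ n)⁻¹ := by gcongr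
    _ = ((2 : ℝ) ^ n)⁻¹ := by
        rw [show (4 : ℝ) = 2 * 2 by norm_num, mul_pow, mul_inv,
          mul_inv_cancel_left₀ (by positivity)]

/-- Nested polar codes achieve the rate-equivocation region. The information set consists of the
indices that are good for the main channel, and the random bits use indices that are good for
the channel of the wiretapper, as many as the rate permits. -/
theorem exists_nestedPolarCode {Y Z : Type*} {W : BinaryChannel Y} {V : BinaryChannel Z}
    (hW : IsSymmetric W) (hV : IsSymmetric V) (hdeg : IsDegraded V W) {R Re : ℝ}
    (hR : R ≤ capacity W) (hRe : Re ≤ capacity W - capacity V) {ε : ℝ} (hε : 0 < ε) :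
    ∃ n₀ : ℕ, ∀ n ≥ n₀, ∃ P : NestedPolarCode n,
      P.rate > R - ε ∧ P.messageErrorProb W < ε ∧ P.blockErrorProb W < ε ∧
        P.equivocation V / 2 ^ n > Re - ε := by
  classical
  rw [hW.capacity_eq] at hR hRe
  rw [hV.capacity_eq] at hRe
  obtain ⟨n₁, hn₁⟩ := exists_card_good_ge W (ε / 2) (by positivity)
  obtain ⟨n₂, hn₂⟩ := exists_pow_lt_of_lt_one (show 0 < ε / 4 by positivity)
    (show (1 / 2 : ℝ) < 1 by norm_num)
  refine ⟨max n₁ n₂, fun n hn => ?_⟩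
  have hsmall : ((2 : ℝ) ^ n)⁻¹ < ε / 4 := by
    rw [← inv_pow, ← one_div]
    exact (pow_le_pow_of_le_one (by norm_num) (by norm_num) ((le_max_right _ _).trans hn)).trans_lt
      hn₂
  have hA := hn₁ n ((le_max_left _ _).trans hn)
  set A := Finset.univ.filter fun i : Fin (2 ^ n) => bhatt (bitKernel W i) ≤ ((4 : ℝ) ^ n)⁻¹
    with hAdef
  set G := Finset.univ.filter fun i : Fin (2 ^ n) => bhatt (bitKernel V i) ≤ ((4 : ℝ) ^ n)⁻¹
    with hGdef
  have hGA : G ⊆ A := fun i hi => by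
    simp only [hAdef, hGdef, Finset.mem_filter, Finset.mem_univ, true_and] at hi ⊢
    exact (hdeg.bhatt_bitKernel_le i).trans hi
  -- The floor is the number of bits of `A` that can be given up without pushing the rate below `R -
  -- ε`. The equivocation bound needs only `B ⊆ G`, so the cardinality of `B` matters just as an
  -- upper bound.
  obtain ⟨B, hBG, hBcard⟩ := Finset.exists_subset_card_eq
    (min_le_left G.card ⌊2 ^ n * (info (realKernel W) - R)⌋₊)
  have hN : (0 : ℝ) < 2 ^ n := by positivity
  have hB : (B.card : ℝ) ≤ 2 ^ n * (info (realKernel W) - R) := by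
    rw [hBcard]
    exact (Nat.cast_le.2 (min_le_right _ _)).trans
      (Nat.floor_le (mul_nonneg hN.le (sub_nonneg.2 hR)))
  have hBN : (B.card : ℝ) ≤ 2 ^ n := by
    exact_mod_cast (Finset.card_le_univ B).trans_eq (Fintype.card_fin _)
  have hZA := sum_bhatt_le W A fun i hi => (Finset.mem_filter.1 hi).2
  have hZB := sum_bhatt_le V B fun i hi => (Finset.mem_filter.1 (hBG hi)).2
  let P : NestedPolarCode n := ⟨A, B, hBG.trans hGA⟩
  have herr : P.blockErrorProb W < ε := by
    have := P.blockErrorProb_le hW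
    linarith [this.trans hZA]
  refine ⟨P, ?_, (P.messageErrorProb_le_blockErrorProb W).trans_lt herr, herr, ?_⟩
  · rw [P.rate_eq, gt_iff_lt, lt_div_iff₀ hN]
    change _ < (A.card : ℝ) - B.card
    nlinarith
  · have heq : (A.card : ℝ) - 2 ^ n * info (realKernel V) - 1 -
        B.card * ∑ i ∈ B, bhatt (bitKernel V i) ≤ P.equivocation V := P.equivocation_ge hV
    have hfano : B.card * ∑ i ∈ B, bhatt (bitKernel V i) ≤ 1 := by
      calc B.card * ∑ i ∈ B, bhatt (bitKernel V i) ≤ B.card * ((2 : ℝ) ^ n)⁻¹ := by gcongr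
        _ ≤ 2 ^ n * ((2 : ℝ) ^ n)⁻¹ := by gcongr
        _ = 1 := mul_inv_cancel₀ hN.ne'
    rw [gt_iff_lt, lt_div_iff₀ hN]
    -- The two unit losses, one bit from the guess and at most one from the error event, together
    -- cost less than `ε / 2` per use; the other `ε / 2` is the deficit in `|A|`.
    have h1 : 1 < ε / 4 * 2 ^ n := by
      rwa [inv_lt_iff_one_lt_mul₀ hN] at hsmall
    nlinarith

end NestedPolar

end

theorem theorem1 {Y Z : Type*}
    (W : NestedPolar.BinaryChannel Y) (V : NestedPolar.BinaryChannel Z)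
    (hW : NestedPolar.IsSymmetric W) (hV : NestedPolar.IsSymmetric V)
    (hdeg : NestedPolar.IsDegraded V W)
    (R Re : ℝ) (hReR : Re ≤ R) (hR : R ≤ NestedPolar.capacity W)
    (hRe0 : 0 ≤ Re) (hRe : Re ≤ NestedPolar.capacity W - NestedPolar.capacity V)
    (ε : ℝ) (hε : 0 < ε) :
    ∃ n₀ : ℕ, ∀ n ≥ n₀, ∃ P : NestedPolar.NestedPolarCode n,
      P.rate > R - ε ∧
      P.messageErrorProb W < ε ∧
      P.blockErrorProb W < ε ∧
      P.equivocation V / 2 ^ n > Re - ε :=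
  NestedPolar.exists_nestedPolarCode hW hV hdeg hR hRe hε
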